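/- Let $(T,\mathscr A)$ and $(X,\mathscr B)$ be standard Borel spaces, and let $\pi:\mathcal E\to X$ be a measurable rank-$d$ real vector bundle with a measurable Euclidean norm $\|\cdot\|$ (the exterior powers $\wedge^k\mathcal E_x$ carry the induced Euclidean norms, and $\|\cdot\|$ of a linear map is the operator norm). Let $f:T\times X\to X$ be measurable, and let $F:T\times\mathcal E\to\mathcal E$ be a random linear bundle morphism covering $f$: $F$ is measurable and, for all $t,x$, it restricts to a linear map $F_{t,x}:\mathcal E_x\to\mathcal E_{f_t(x)}$ (possibly singular). For $\omega\in\Omega=T^{\mathbb N}$ put $f^0_\omega=\mathrm{id}$, $f^n_\omega=f_{\omega_{n-1}}\circ\cdots\circ f_{\omega_0}$ and $$F^n_{(\omega,x)}=F_{\omega_{n-1},f^{n-1}_\omega(x)}\circ\cdots\circ F_{\omega_0,x}.$$ Let $p$ be a probability measure on $T$, $\mathbb P=p^{\mathbb N}$, and let $\mu$ be an $f$-stationary probability measure on $X$, i.e. $\int\!\int\varphi(f_t(x))\,dp(t)\,d\mu(x)=\int\varphi\,d\mu$ for all bounded measurable $\varphi:X\to\mathbb R$. Assume $\int\log^+\|F_{t,x}\|\,d(p\times\mu)(t,x)<\infty$,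 and let $m=\mathbb P\times\mu$. For $1\le k\le d$ put $\Sigma_k(\omega,x)=\lim_{n\to\infty}\frac1n\log\|\wedge^kF^n_{(\omega,x)}\|\in[-\infty,\infty)$ (the limit exists $m$-a.e. by Kingman's theorem; where it does not exist take the upper limit), $\Sigma_k(m)=\int\Sigma_k(\omega,x)\,dm$ and $\Sigma_0(m)=0$. The Lyapunov exponents are $\lambda_k(m)=\Sigma_k(m)-\Sigma_{k-1}(m)$ if $\Sigma_{k-1}(m)>-\infty$, and $\lambda_k(m)=-\infty$ otherwise. Then, for every $1\le k\le d$, with the convention $\log 0=-\infty$ and with $[v]$ ranging over the lines spanned by nonzero $v\in\wedge^k\mathcal E_x$, $$\sum_{i=1}^k\lambda_i(m)=\lim_{n\to\infty}\frac1n\int\!\!\int\sup_{[v]}\log\frac{\|\wedge^kF^n_{(\omega,x)}v\|}{\|v\|}\,d\mathbb P(\omega)\,d\mu(x)$$ $$=\lim_{n\to\infty}\frac1n\int\sup_{[v]}\biggl(\int\log\frac{\|\wedge^kF^n_{(\omega,x)}v\|}{\|v\|}\,d\mathbb P(\omega)\biggr)d\mu(x),$$ where both limits exist in $[-\infty,\infty)$.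 All integrals here, including those defining $\Sigma_i(m)$ for $1\le i\le k$, are well defined in $[-\infty,\infty)$: the integrands are measurable up to null sets and have integrable positive part (for the inner integrals over $\Omega$, this holds for $\mu$-a.e. $x$ and, in the last formula, every $[v]$). -/

import Mathlib

open MeasureTheory Filter Topology
open scoped ENNReal

noncomputable section

namespace RandomBundle

/-! ### Extended logarithm and extended integral -/

/-- The logarithm of a nonnegative real number, with `log 0 = -∞`. -/
def elog (r : ℝ) : EReal := ENNReal.log (ENNReal.ofReal r)

/-- The integral `∫ h dμ = ∫ h⁺ dμ - ∫ h⁻ dμ` of an extended real function. It has its usual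
meaning for functions satisfying `QuasiIntegrable`. -/
def eintegral {α : Type*} [MeasurableSpace α] (μ : Measure α) (h : α → EReal) : EReal :=
  ((∫⁻ a, (h a).toENNReal ∂μ : ℝ≥0∞) : EReal) - ((∫⁻ a, (-h a).toENNReal ∂μ : ℝ≥0∞) : EReal)

/-- `h` is measurable (up to a null set) and `h⁺` is integrable, so that `∫ h dμ` is well defined
in `[-∞, ∞)`. -/
def QuasiIntegrable {α : Type*} [MeasurableSpace α] (μ : Measure α) (h : α → EReal) : Prop :=
  AEMeasurable h μ ∧ ∫⁻ a, (h a).toENNReal ∂μ < ∞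

/-! ### Measurable Euclidean vector bundles -/

/-- The total space of a family of vector spaces `E x` of rank `d`. -/
abbrev Total (d : ℕ) {X : Type*} (E : X → Type*) : Type _ :=
  Bundle.TotalSpace (EuclideanSpace ℝ (Fin d)) E

/-- A measurable rank-`d` vector bundle with a measurable Euclidean norm: the total space carries
a σ-algebra for which the projection and the norm are measurable, and the base has a countable
measurable cover over each member of which the bundle is isomorphic, measurably in both directions
and linearly on the fibres, to a product with `ℝ^d`. The norm on each fibre is Euclidean because
the fibres are inner product spaces. -/
structure IsMeasurableEuclideanBundle (d : ℕ) {X : Type*} [MeasurableSpace X] (E : X → Type*)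
    [∀ x, NormedAddCommGroup (E x)] [∀ x, InnerProductSpace ℝ (E x)]
    [MeasurableSpace (Total d E)] : Prop where
  measurable_proj : Measurable (fun e : Total d E => e.proj)
  measurable_norm : Measurable (fun e : Total d E => ‖e.snd‖)
  exists_trivializations : ∃ (U : ℕ → Set X)
      (L : ∀ (_ : ℕ) (x : X), E x ≃ₗ[ℝ] EuclideanSpace ℝ (Fin d)),
    (∀ i, MeasurableSet (U i)) ∧ (⋃ i, U i) = Set.univ ∧
    (∀ i, Measurable (fun e : {e : Total d E // e.proj ∈ U i} => L i e.1.proj e.1.snd)) ∧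
    (∀ i, Measurable (fun z : U i × EuclideanSpace ℝ (Fin d) =>
      (⟨z.1.1, (L i z.1.1).symm z.2⟩ : Total d E)))

/-! ### Random linear bundle morphisms -/

/-- A random linear bundle morphism `F : T × E → E` covering a random map `f : T × X → X`. -/
structure RandomBundleMorphism (T : Type*) [MeasurableSpace T] (d : ℕ) {X : Type*}
    [MeasurableSpace X] (E : X → Type*) [∀ x, NormedAddCommGroup (E x)]
    [∀ x, InnerProductSpace ℝ (E x)] [MeasurableSpace (Total d E)] where
  /-- the random map `f` -/
  f : T → X → X
  measurable_f : Measurable (fun z : T × X => f z.1 z.2)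
  /-- the linear maps `F_{t,x} : E_x → E_{f_t(x)}` -/
  F : ∀ (t : T) (x : X), E x →ₗ[ℝ] E (f t x)
  measurable_F : Measurable (fun z : T × Total d E =>
    (⟨f z.1 z.2.proj, F z.1 z.2.proj z.2.snd⟩ : Total d E))

/-- The Bernoulli measure `ℙ = p^ℕ` on `Ω = T^ℕ`. -/
def bernoulli {T : Type*} [MeasurableSpace T] (p : Measure T) [IsProbabilityMeasure p] :
    Measure (ℕ → T) :=
  Measure.infinitePi (fun _ : ℕ => p)

namespace RandomBundleMorphism

variable {T : Type*} [MeasurableSpace T] {d : ℕ} {X : Type*} [MeasurableSpace X] {E : X → Type*}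
  [∀ x, NormedAddCommGroup (E x)] [∀ x, InnerProductSpace ℝ (E x)] [MeasurableSpace (Total d E)]
  (R : RandomBundleMorphism T d E)

/-- The random orbit `f_ω^n(x)`, where `f_ω^n = f_{ω_{n-1}} ∘ ⋯ ∘ f_{ω_0}`. -/
def orbit (ω : ℕ → T) (x : X) : ℕ → X
  | 0 => x
  | n + 1 => R.f (ω n) (orbit ω x n)

/-- The iterates `F^n_{(ω,x)} : E_x → E_{f_ω^n(x)}`, the composition of the maps
`F_{ω_j, f_ω^j(x)}` for `j = 0, …, n - 1`. -/
def iter (ω : ℕ → T) (x : X) : ∀ n : ℕ, E x →ₗ[ℝ] E (R.orbit ω x n)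
  | 0 => LinearMap.id
  | n + 1 => R.F (ω n) (R.orbit ω x n) ∘ₗ iter ω x n

/-- The annealed Koopman operator `φ ↦ ∫ φ (f_t(·)) dp(t)`. -/
def annealedKoopman (p : Measure T) (φ : X → ℝ) (x : X) : ℝ := ∫ t, φ (R.f t x) ∂p

/-- `μ` is `f`-stationary: it is invariant under the dual of the annealed Koopman operator acting
on bounded measurable functions. -/
def IsStationary (p : Measure T) (μ : Measure X) : Prop :=
  ∀ φ : X → ℝ, Measurable φ → (∃ C : ℝ, ∀ x, |φ x| ≤ C) →
    ∫ x, R.annealedKoopman p φ x ∂μ = ∫ x, φ x ∂μ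

variable [∀ x, FiniteDimensional ℝ (E x)]

/-- The integrability condition `∫ log⁺ ‖F_{t,x}‖ d(p × μ) < ∞` (operator norm). -/
def LogIntegrable (p : Measure T) (μ : Measure X) : Prop :=
  Integrable (fun z : T × X => Real.posLog ‖(R.F z.1 z.2).toContinuousLinearMap‖) (p.prod μ)

/-- `log ‖∧^k F^n_{(ω,x)}‖` in `[-∞, ∞)`, with the operator norm induced by the Euclidean norms on
the exterior powers. -/
def logNorm (k n : ℕ) (ω : ℕ → T) (x : X) : EReal :=
  elog ‖(exteriorPower.map k (R.iter ω x n)).toContinuousLinearMap‖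

/-- `log (‖∧^k F^n_{(ω,x)} v‖ / ‖v‖)` in `[-∞, ∞)`. For `v ≠ 0` it depends only on the
line `[v]`. -/
def logGrowth (k n : ℕ) (ω : ℕ → T) (x : X) (v : ⋀[ℝ]^k (E x)) : EReal :=
  elog (‖exteriorPower.map k (R.iter ω x n) v‖ / ‖v‖)

/-- The pointwise growth rate `Σ_k(ω,x)`, the limit of `(1/n) log ‖∧^k F^n_{(ω,x)}‖`. The limit
exists almost everywhere for an invariant measure (Kingman); the upper limit is used so that the
function is defined everywhere. -/
def pointwiseSum (k : ℕ) (z : (ℕ → T) × X) : EReal :=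
  limsup (fun n : ℕ => R.logNorm k n z.1 z.2 / (n : EReal)) atTop

/-- `Σ_k(m) = ∫ Σ_k(ω,x) dm`, with `Σ_0(m) = 0`. -/
def sumRate (m : Measure ((ℕ → T) × X)) (k : ℕ) : EReal :=
  if k = 0 then 0 else eintegral m (R.pointwiseSum k)

open Classical in
/-- The Lyapunov exponents `λ_k(m)`, `k ≥ 1`: `Σ_k(m) - Σ_{k-1}(m)` if `Σ_{k-1}(m) > -∞`, and
`-∞` otherwise. -/
def lyapunovExponent (m : Measure ((ℕ → T) × X)) (k : ℕ) : EReal :=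
  if R.sumRate m (k - 1) = ⊥ then ⊥ else R.sumRate m k - R.sumRate m (k - 1)

end RandomBundleMorphism

end RandomBundle

end

/-! By stationarity the skew product `skew` preserves ℙ × μ, and log ‖∧^k F^n‖ is a subadditive
cocycle over it whose positive part at time one is integrable. Kingman's theorem in the mean
(`tendsto_eintegral_div_of_subadditive`) gives (1/n) ∫ log ‖∧^k F^n‖ → Σ_k(m). The supremum over
lines of the pointwise growth is the logarithm of the operator norm, so Fubini yields the first
formula once λ_1 + ⋯ + λ_k is identified with Σ_k(m). This is telescoping, except that Σ_k(m) = -∞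
must force Σ_{k+1}(m) = -∞; the bound ‖∧^{k+1}A‖ ≤ C ‖∧^k A‖ ‖A‖ ensures it.

In the second formula, pulling the supremum out of the integral can only decrease it. The loss is
bounded independently of n (`eintegral_elog_norm_sub_le_iSup`): for a Gaussian vector v, the mean of
log ‖A‖ - log (‖Av‖/‖v‖) is at most a constant K depending only on the dimension, because ‖Av‖
dominates |⟨w, v⟩| for some w with ‖w‖ ≥ ‖A‖/2 and log |s| is integrable near 0. Averaging over both
v and ω, some deterministic v loses at most K in expectation, and K/n → 0.

Singular maps make the value -∞ unavoidable. Kingman's theorem is therefore proved first for [0,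
∞]-valued processes, applied to (φ_n + Cn)⁺, and then C → ∞. Only integrals and upper limits occur,
so the upper half of Birkhoff's theorem suffices. The other delicate point is measurability in x of
a supremum over uncountably many lines of integrals; truncation and compactness of the sphere reduce
it to countable operations. -/

noncomputable section

namespace RandomBundle

set_option linter.unusedSectionVars false

/-! ### Maximal ergodic theorem and nonnegative subadditive processes -/

section Ergodic

variable {Z : Type*} [MeasurableSpace Z] {m : Measure Z} {S : Z → Z}

theorem measurable_birkhoffSum (hS : Measurable S) {g : Z → ℝ≥0∞} (hg : Measurable g) (n : ℕ) :
    Measurable (birkhoffSum S g n) := by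
  unfold birkhoffSum
  exact Finset.measurable_fun_sum _ fun j _ => hg.comp (hS.iterate j)

theorem lintegral_birkhoffSum (hS : MeasurePreserving S m m) {g : Z → ℝ≥0∞} (hg : Measurable g)
    (n : ℕ) : ∫⁻ z, birkhoffSum S g n z ∂m = n * ∫⁻ z, g z ∂m := by
  simp only [birkhoffSum]
  rw [lintegral_finsetSum (f := fun j z => g (S^[j] z)) _
    fun j _ => hg.comp (hS.measurable.iterate j)]
  simp [(hS.iterate _).lintegral_comp hg]

/-- The truncated maximal process used in Garsia's proof of the maximal ergodic theorem. -/
def garsiaMax (S : Z → Z) (g h : Z → ℝ≥0∞) : ℕ → Z → ℝ≥0∞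
  | 0 => fun _ => 0
  | n + 1 => fun z => (g z + garsiaMax S g h n (S z)) - h z

theorem measurable_garsiaMax (hS : Measurable S) {g h : Z → ℝ≥0∞} (hg : Measurable g)
    (hh : Measurable h) (n : ℕ) : Measurable (garsiaMax S g h n) := by
  induction n with
  | zero => exact measurable_const
  | succ n ih => exact (hg.add (ih.comp hS)).sub hh

theorem garsiaMax_le_succ (S : Z → Z) (g h : Z → ℝ≥0∞) (n : ℕ) (z : Z) :
    garsiaMax S g h n z ≤ garsiaMax S g h (n + 1) z := by
  induction n generalizing z with
  | zero => exact zero_le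
  | succ n ih => exact tsub_le_tsub_right (add_le_add le_rfl (ih (S z))) _

/-- `garsiaMax` dominates the Birkhoff sums of g - h, and each h (S^j z) is at most h z by
subinvariance. -/
theorem birkhoffSum_le_garsiaMax {g h : Z → ℝ≥0∞} (hinv : ∀ z, h (S z) ≤ h z) (n : ℕ) (z : Z) :
    birkhoffSum S g n z ≤ garsiaMax S g h n z + n * h z := by
  induction n generalizing z with
  | zero => simp [birkhoffSum_zero]
  | succ n ih =>
    rw [birkhoffSum_succ']
    calc g z + birkhoffSum S g n (S z)
        ≤ g z + (garsiaMax S g h n (S z) + n * h z) := by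
          gcongr
          exact (ih (S z)).trans (by gcongr; exact hinv z)
      _ = (g z + garsiaMax S g h n (S z)) + n * h z := by ring
      _ ≤ (garsiaMax S g h (n + 1) z + h z) + n * h z := by
          refine add_le_add ?_ le_rfl
          exact le_tsub_add (a := h z) (b := g z + garsiaMax S g h n (S z))
      _ = garsiaMax S g h (n + 1) z + (n + 1 : ℕ) * h z := by push_cast; ring

theorem lintegral_garsiaMax_le (hS : MeasurePreserving S m m) {g h : Z → ℝ≥0∞} (hg : Measurable g)
    (hh : Measurable h) (n : ℕ) :
    ∫⁻ z, garsiaMax S g h n z ∂m ≤ n * ∫⁻ z, g z ∂m := by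
  induction n with
  | zero => simp [garsiaMax]
  | succ n ih =>
    calc ∫⁻ z, garsiaMax S g h (n + 1) z ∂m ≤ ∫⁻ z, (g z + garsiaMax S g h n (S z)) ∂m :=
          lintegral_mono fun z => tsub_le_self
      _ = ∫⁻ z, g z ∂m + ∫⁻ z, garsiaMax S g h n z ∂m := by
          rw [lintegral_add_left hg, hS.lintegral_comp (measurable_garsiaMax hS.measurable hg hh n)]
      _ ≤ ∫⁻ z, g z ∂m + n * ∫⁻ z, g z ∂m := by gcongr
      _ = (n + 1 : ℕ) * ∫⁻ z, g z ∂m := by push_cast; ring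

/-- A form of the maximal ergodic theorem. -/
theorem setLIntegral_garsiaMax_pos_le (hS : MeasurePreserving S m m) {g h : Z → ℝ≥0∞}
    (hg : Measurable g) (hh : Measurable h) (hgi : ∫⁻ z, g z ∂m ≠ ∞) (n : ℕ) :
    ∫⁻ z in {z | garsiaMax S g h (n + 1) z ≠ 0}, h z ∂m ≤ ∫⁻ z, g z ∂m := by
  set P : Set Z := {z | garsiaMax S g h (n + 1) z ≠ 0} with hP
  have hMm := fun n => measurable_garsiaMax hS.measurable hg hh n
  have hPm : MeasurableSet P := (hMm (n + 1)) (measurableSet_singleton 0).compl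
  have hfin : ∫⁻ z, garsiaMax S g h (n + 1) z ∂m ≠ ∞ :=
    ((lintegral_garsiaMax_le hS hg hh (n + 1)).trans_lt
      (ENNReal.mul_lt_top (by simp) hgi.lt_top)).ne
  have hMP : ∫⁻ z in P, garsiaMax S g h (n + 1) z ∂m = ∫⁻ z, garsiaMax S g h (n + 1) z ∂m := by
    rw [← lintegral_indicator hPm]
    refine lintegral_congr fun z => ?_
    by_cases hz : z ∈ P
    · simp [hz]
    · simp_all
  -- Add the finite integral of the maximal process to both sides. On P the subtraction of h is not
  -- truncated, so the recursion is an equality there; off P the maximal process vanishes.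
  refine (ENNReal.add_le_add_iff_left hfin).1 ?_
  calc ∫⁻ z, garsiaMax S g h (n + 1) z ∂m + ∫⁻ z in P, h z ∂m
      = ∫⁻ z in P, (garsiaMax S g h (n + 1) z + h z) ∂m := by
        rw [lintegral_add_left (hMm _), hMP]
    _ ≤ ∫⁻ z in P, (g z + garsiaMax S g h n (S z)) ∂m := by
        refine setLIntegral_mono' hPm fun z hz => ?_
        have : 0 < (g z + garsiaMax S g h n (S z)) - h z := pos_iff_ne_zero.2 hz
        exact (tsub_add_cancel_of_le (tsub_pos_iff_lt.1 this).le).le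
    _ ≤ ∫⁻ z, (g z + garsiaMax S g h n (S z)) ∂m := setLIntegral_le_lintegral _ _
    _ = ∫⁻ z, g z ∂m + ∫⁻ z, garsiaMax S g h n z ∂m := by
        rw [lintegral_add_left hg, hS.lintegral_comp (hMm n)]
    _ ≤ ∫⁻ z, garsiaMax S g h (n + 1) z ∂m + ∫⁻ z, g z ∂m := by
        rw [add_comm]
        gcongr
        exact garsiaMax_le_succ S g h n _

/-- The sum of n terms from S z is part of the sum of n + 1 terms from z, and (n + 1)/n → 1. This is
the subinvariance required by the maximal theorem. -/
theorem limsup_birkhoffSum_div_comp_le (S : Z → Z) (g : Z → ℝ≥0∞) (z : Z) :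
    limsup (fun n : ℕ => birkhoffSum S g n (S z) / n) atTop ≤
      limsup (fun n : ℕ => birkhoffSum S g n z / n) atTop := by
  set l := limsup (fun n : ℕ => birkhoffSum S g n z / n) atTop with hl
  refine le_of_forall_gt_imp_ge_of_dense fun r hr => ?_
  have hr0 : r ≠ 0 := (zero_le.trans_lt hr).ne'
  have hev : ∀ᶠ n : ℕ in atTop, birkhoffSum S g (n + 1) z / (n + 1 : ℕ) < r :=
    (tendsto_add_atTop_nat 1).eventually (eventually_lt_of_limsup_lt hr)
  have hlim : Tendsto (fun n : ℕ => ((n : ℝ≥0∞)⁻¹ + 1) * r) atTop (𝓝 ((0 + 1) * r)) :=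
    ENNReal.Tendsto.mul_const
      (ENNReal.tendsto_inv_nat_nhds_zero.add tendsto_const_nhds) (by simp)
  rw [zero_add, one_mul] at hlim
  rw [← hlim.limsup_eq]
  refine limsup_le_limsup ?_
  filter_upwards [hev, eventually_gt_atTop 0] with n hn hn0
  have hn' : (n : ℝ≥0∞) ≠ 0 := by exact_mod_cast hn0.ne'
  have h1 : birkhoffSum S g (n + 1) z ≤ r * (n + 1 : ℕ) :=
    (ENNReal.div_le_iff (by simp) (by simp)).1 hn.le
  rw [birkhoffSum_succ'] at h1
  rw [ENNReal.div_le_iff hn' (by simp)]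
  calc birkhoffSum S g n (S z) ≤ r * (n + 1 : ℕ) := le_add_self.trans h1
    _ = ((n : ℝ≥0∞)⁻¹ + 1) * r * n := by
        have h2 : ((n : ℝ≥0∞)⁻¹ + 1) * n = (n + 1 : ℕ) := by
          rw [add_mul, ENNReal.inv_mul_cancel hn' (by simp)]
          push_cast
          ring
        rw [← h2]
        ring

/-- The half of Birkhoff's theorem that bounds the upper limit of the averages. -/
theorem lintegral_limsup_birkhoffSum_le [IsProbabilityMeasure m] (hS : MeasurePreserving S m m)
    {g : Z → ℝ≥0∞} (hg : Measurable g) :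
    ∫⁻ z, limsup (fun n : ℕ => birkhoffSum S g n z / n) atTop ∂m ≤ ∫⁻ z, g z ∂m := by
  by_cases hgi : ∫⁻ z, g z ∂m = ∞
  · simp [hgi]
  set l : Z → ℝ≥0∞ := fun z => limsup (fun n : ℕ => birkhoffSum S g n z / n) atTop with hl
  have hlm : Measurable l :=
    Measurable.limsup fun n => (measurable_birkhoffSum hS.measurable hg n).div_const _
  have key : ∀ (M : ℕ) (ε : ℝ≥0∞), ε ≠ 0 → ε ≠ ∞ →
      ∫⁻ z, min (l z) M ∂m ≤ ∫⁻ z, g z ∂m + ε := by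
    -- Capping the limsup at M keeps h finite, and adding ε to g makes the comparison strict.
    intro M ε hε hε'
    set h : Z → ℝ≥0∞ := fun z => min (l z) M with hh
    have hhm : Measurable h := hlm.min measurable_const
    have hinv : ∀ z, h (S z) ≤ h z := fun z =>
      min_le_min_right _ (limsup_birkhoffSum_div_comp_le S g z)
    have hgε : Measurable fun z => g z + ε := hg.add_const ε
    have hint : ∫⁻ z, (g z + ε) ∂m = ∫⁻ z, g z ∂m + ε := by
      rw [lintegral_add_left hg]; simp
    set P : ℕ → Set Z := fun n => {z | garsiaMax S (fun z => g z + ε) h (n + 1) z ≠ 0} with hP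
    have hPmono : Monotone P := by
      refine monotone_nat_of_le_succ fun n z hz => ?_
      have h0 : 0 < garsiaMax S (fun z => g z + ε) h (n + 1) z := pos_iff_ne_zero.2 hz
      exact (h0.trans_le (garsiaMax_le_succ S _ h (n + 1) z)).ne'
    -- If the maximal process vanished at z for every n, all averages of g + ε would be at most h z,
    -- hence l z + ε ≤ h z ≤ l z with h z finite, which is absurd.
    have hPuniv : ⋃ n, P n = Set.univ := by
      refine Set.eq_univ_of_forall fun z => ?_
      by_contra hz
      have h0 : ∀ n, garsiaMax S (fun z => g z + ε) h (n + 1) z = 0 := by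
        simpa [hP] using hz
      have hfin : h z ≠ ∞ := ((min_le_right _ _).trans_lt (ENNReal.natCast_lt_top M)).ne
      have hle : l z + ε ≤ h z := by
        have : ∀ᶠ n : ℕ in atTop, birkhoffSum S g n z / n + ε ≤ h z := by
          filter_upwards [eventually_gt_atTop 0] with n hn
          obtain ⟨n, rfl⟩ := Nat.exists_eq_succ_of_ne_zero hn.ne'
          have hs := birkhoffSum_le_garsiaMax (g := fun z => g z + ε) hinv (n + 1) z
          rw [h0, zero_add] at hs
          have hb : birkhoffSum S (fun z => g z + ε) (n + 1) z =
              birkhoffSum S g (n + 1) z + (n + 1 : ℕ) * ε := by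
            simp [birkhoffSum, Finset.sum_add_distrib]
          have hc : ((n + 1 : ℕ) : ℝ≥0∞) ≠ 0 := by simp
          rw [hb] at hs
          rw [Nat.succ_eq_add_one]
          have : birkhoffSum S g (n + 1) z / (n + 1 : ℕ) + ε =
              (birkhoffSum S g (n + 1) z + (n + 1 : ℕ) * ε) / (n + 1 : ℕ) := by
            rw [ENNReal.add_div, mul_comm, ENNReal.mul_div_cancel_right hc (by simp)]
          rw [this, ENNReal.div_le_iff hc (by simp), mul_comm (h z)]
          exact hs
        have h2 : ∀ᶠ n : ℕ in atTop, birkhoffSum S g n z / n ≤ h z - ε :=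
          this.mono fun n hn => ENNReal.le_sub_of_add_le_right hε' hn
        have h3 : l z ≤ h z - ε := limsup_le_of_le (by isBoundedDefault) h2
        have h4 : ε ≤ h z := by
          obtain ⟨n, hn⟩ := this.exists
          exact le_add_self.trans hn
        calc l z + ε ≤ h z - ε + ε := by gcongr
          _ = h z := tsub_add_cancel_of_le h4
      have : h z + ε ≤ h z := le_trans (by gcongr; exact min_le_left _ _) hle
      exact absurd this (not_le.2 (ENNReal.lt_add_right hfin hε))
    rw [← setLIntegral_univ, ← hPuniv, setLIntegral_iUnion_of_directed _ hPmono.directed_le]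
    refine iSup_le fun n => ?_
    rw [← hint]
    exact setLIntegral_garsiaMax_pos_le hS hgε hhm (by rw [hint]; simp [hgi, hε']) n
  have key2 : ∀ M : ℕ, ∫⁻ z, min (l z) M ∂m ≤ ∫⁻ z, g z ∂m := by
    intro M
    refine ENNReal.le_of_forall_pos_le_add fun ε hε _ => key M ε (by simpa using hε.ne') (by simp)
  have hsup : ∀ z, l z = ⨆ M : ℕ, min (l z) M := by
    intro z
    rw [← inf_iSup_eq, ENNReal.iSup_natCast]; simp
  calc ∫⁻ z, l z ∂m = ∫⁻ z, ⨆ M : ℕ, min (l z) M ∂m := lintegral_congr hsup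
    _ = ⨆ M : ℕ, ∫⁻ z, min (l z) M ∂m :=
        lintegral_iSup (fun M => hlm.min measurable_const)
          (fun a b hab z => min_le_min_left _ (by exact_mod_cast hab))
    _ ≤ ∫⁻ z, g z ∂m := iSup_le key2

theorem ennreal_limsup_add_le {ι : Type*} {l : Filter ι} (u v : ι → ℝ≥0∞) :
    limsup (fun i => u i + v i) l ≤ limsup u l + limsup v l := by
  by_cases hu : limsup u l = ∞
  · simp [hu]
  by_cases hv : limsup v l = ∞
  · simp [hv]
  refine ENNReal.le_of_forall_pos_le_add fun ε hε _ => ?_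
  have hε' : ((ε / 2 : NNReal) : ℝ≥0∞) ≠ 0 := by simpa using hε.ne'
  refine limsup_le_of_le (by isBoundedDefault) ?_
  filter_upwards [eventually_lt_of_limsup_lt (ENNReal.lt_add_right hu hε'),
    eventually_lt_of_limsup_lt (ENNReal.lt_add_right hv hε')] with i hi hj
  calc u i + v i ≤ (limsup u l + (ε / 2 : NNReal)) + (limsup v l + (ε / 2 : NNReal)) :=
        add_le_add hi.le hj.le
    _ = limsup u l + limsup v l + ((ε / 2 + ε / 2 : NNReal) : ℝ≥0∞) := by push_cast; ring
    _ = limsup u l + limsup v l + ε := by rw [add_halves]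

theorem tendsto_lintegral_tsub_natCast {g : Z → ℝ≥0∞} (hg : Measurable g)
    (hgi : ∫⁻ z, g z ∂m ≠ ∞) :
    Tendsto (fun M : ℕ => ∫⁻ z, (g z - M) ∂m) atTop (𝓝 0) := by
  have := tendsto_lintegral_of_dominated_convergence (μ := m) (F := fun (M : ℕ) z => g z - M)
    (f := fun _ => 0) g (fun M => hg.sub measurable_const)
    (fun M => ae_of_all _ fun z => tsub_le_self) hgi ?_
  · simpa using this
  · filter_upwards [ae_lt_top hg hgi] with z hz
    obtain ⟨N, hN⟩ := ENNReal.exists_nat_gt hz.ne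
    refine tendsto_const_nhds.congr' ?_
    filter_upwards [eventually_ge_atTop N] with n hn
    exact (tsub_eq_zero_of_le (hN.le.trans (by exact_mod_cast hn))).symm

/-- Write h ≤ M + k with k = (h - M)⁺. The term k (S^q z) is at most the Birkhoff sum of k of length
q + 1 ≤ 2q, so the limsup is at most twice that of the averages of k, whose integral is at most ∫ k
→ 0 as M → ∞. -/
theorem lintegral_limsup_comp_iterate_div [IsProbabilityMeasure m] (hS : MeasurePreserving S m m)
    {h : Z → ℝ≥0∞} (hh : Measurable h) (hhi : ∫⁻ z, h z ∂m ≠ ∞) :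
    ∫⁻ z, limsup (fun q : ℕ => h (S^[q] z) / q) atTop ∂m = 0 := by
  have key : ∀ M : ℕ, ∫⁻ z, limsup (fun q : ℕ => h (S^[q] z) / q) atTop ∂m ≤
      2 * ∫⁻ z, (h z - M) ∂m := by
    intro M
    set k : Z → ℝ≥0∞ := fun z => h z - M with hk
    have hkm : Measurable k := hh.sub measurable_const
    calc ∫⁻ z, limsup (fun q : ℕ => h (S^[q] z) / q) atTop ∂m
        ≤ ∫⁻ z, 2 * limsup (fun n : ℕ => birkhoffSum S k n z / n) atTop ∂m := by
          refine lintegral_mono fun z => ?_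
          have hM : Tendsto (fun q : ℕ => (M : ℝ≥0∞) / q) atTop (𝓝 0) := by
            have := ENNReal.Tendsto.const_mul (a := (M : ℝ≥0∞)) ENNReal.tendsto_inv_nat_nhds_zero
              (Or.inr (by simp))
            simpa [div_eq_mul_inv] using this
          calc limsup (fun q : ℕ => h (S^[q] z) / q) atTop
              ≤ limsup (fun q : ℕ => (M : ℝ≥0∞) / q +
                  2 * (birkhoffSum S k (q + 1) z / (q + 1 : ℕ))) atTop := by
                refine limsup_le_limsup ?_
                filter_upwards [eventually_gt_atTop 0] with q hq
                have hq' : (q : ℝ≥0∞) ≠ 0 := by exact_mod_cast hq.ne'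
                have h1 : h (S^[q] z) ≤ M + birkhoffSum S k (q + 1) z := by
                  rw [birkhoffSum_succ]
                  calc h (S^[q] z) ≤ M + k (S^[q] z) := le_add_tsub
                    _ ≤ _ := by gcongr; exact le_add_self
                calc h (S^[q] z) / q ≤ (M + birkhoffSum S k (q + 1) z) / q := by gcongr
                  _ = (M : ℝ≥0∞) / q + birkhoffSum S k (q + 1) z / q := ENNReal.add_div
                  _ ≤ _ := by
                      gcongr
                      set b := birkhoffSum S k (q + 1) z
                      rw [ENNReal.div_le_iff hq' (by simp)]
                      calc b = b / (q + 1 : ℕ) * (q + 1 : ℕ) :=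
                            (ENNReal.div_mul_cancel (by simp) (by simp)).symm
                        _ ≤ b / (q + 1 : ℕ) * (2 * q : ℕ) := by gcongr; omega
                        _ = 2 * (b / (q + 1 : ℕ)) * q := by push_cast; ring
            _ ≤ limsup (fun q : ℕ => (M : ℝ≥0∞) / q) atTop + limsup (fun q : ℕ =>
                  2 * (birkhoffSum S k (q + 1) z / (q + 1 : ℕ))) atTop := ennreal_limsup_add_le _ _
            _ = 2 * limsup (fun n : ℕ => birkhoffSum S k n z / n) atTop := by
                rw [hM.limsup_eq, zero_add, ENNReal.limsup_const_mul_of_ne_top (by simp)]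
                congr 1
                exact limsup_nat_add (fun n : ℕ => birkhoffSum S k n z / n) 1
      _ = 2 * ∫⁻ z, limsup (fun n : ℕ => birkhoffSum S k n z / n) atTop ∂m :=
          lintegral_const_mul _ (Measurable.limsup fun n =>
            (measurable_birkhoffSum hS.measurable hkm n).div_const _)
      _ ≤ 2 * ∫⁻ z, k z ∂m := mul_le_mul_right (lintegral_limsup_birkhoffSum_le hS hkm) _
  have hlim : Tendsto (fun M : ℕ => 2 * ∫⁻ z, (h z - M) ∂m) atTop (𝓝 (2 * 0)) :=
    ENNReal.Tendsto.const_mul (tendsto_lintegral_tsub_natCast hh hhi) (Or.inr (by simp))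
  rw [mul_zero] at hlim
  exact le_antisymm (ge_of_tendsto' hlim key) zero_le

/-- A subadditive sequence of `[0, ∞]`-valued functions over `S`. -/
structure IsSubadditiveProcess (S : Z → Z) (a : ℕ → Z → ℝ≥0∞) : Prop where
  measurable : ∀ n, Measurable (a n)
  zero : ∀ z, a 0 z = 0
  add_le : ∀ n k z, a (n + k) z ≤ a n z + a k (S^[n] z)

namespace IsSubadditiveProcess

variable {a : ℕ → Z → ℝ≥0∞}

theorem le_birkhoffSum (h : IsSubadditiveProcess S a) (n : ℕ) (z : Z) :
    a n z ≤ birkhoffSum S (a 1) n z := by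
  induction n with
  | zero => simp [h.zero]
  | succ n ih =>
    rw [birkhoffSum_succ]
    exact (h.add_le n 1 z).trans (by gcongr)

theorem mul_le_birkhoffSum (h : IsSubadditiveProcess S a) (N q : ℕ) (z : Z) :
    a (N * q) z ≤ birkhoffSum (S^[N]) (a N) q z := by
  induction q with
  | zero => simp [h.zero]
  | succ q ih =>
    rw [birkhoffSum_succ, ← Function.iterate_mul, mul_add, mul_one]
    exact (h.add_le (N * q) N z).trans (by gcongr)

theorem lintegral_le [IsProbabilityMeasure m] (h : IsSubadditiveProcess S a)
    (hS : MeasurePreserving S m m) (n : ℕ) : ∫⁻ z, a n z ∂m ≤ n * ∫⁻ z, a 1 z ∂m := by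
  rw [← lintegral_birkhoffSum hS (h.measurable 1)]
  exact lintegral_mono (h.le_birkhoffSum n)

/-- Divide n by N with quotient q: the q full blocks give a Birkhoff sum for S^N, and the remainder,
of length below N, is bounded by one fixed function evaluated at time Nq. Its contribution has
vanishing integral by `lintegral_limsup_comp_iterate_div`. -/
theorem limsup_div_le (h : IsSubadditiveProcess S a) {N : ℕ} (hN : 0 < N) (z : Z) :
    limsup (fun n : ℕ => a n z / n) atTop ≤
      (N : ℝ≥0∞)⁻¹ * limsup (fun q : ℕ => birkhoffSum (S^[N]) (a N) q z / q) atTop +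
      (N : ℝ≥0∞)⁻¹ * limsup (fun q : ℕ => birkhoffSum S (a 1) N ((S^[N])^[q] z) / q) atTop := by
  have hN' : (N : ℝ≥0∞) ≠ 0 := by exact_mod_cast hN.ne'
  have hNi : (N : ℝ≥0∞)⁻¹ ≠ ∞ := by simp [hN.ne']
  set u : ℕ → ℝ≥0∞ := fun q => (N : ℝ≥0∞)⁻¹ * (birkhoffSum (S^[N]) (a N) q z / q) +
    (N : ℝ≥0∞)⁻¹ * (birkhoffSum S (a 1) N ((S^[N])^[q] z) / q) with hu
  have hdiv : Tendsto (fun n : ℕ => n / N) atTop atTop := Nat.tendsto_div_const_atTop hN.ne'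
  calc limsup (fun n : ℕ => a n z / n) atTop ≤ limsup (fun n : ℕ => u (n / N)) atTop := by
        refine limsup_le_limsup ?_
        filter_upwards [eventually_ge_atTop N] with n hn
        have hq : 0 < n / N := Nat.div_pos hn hN
        have hq' : ((n / N : ℕ) : ℝ≥0∞) ≠ 0 := by exact_mod_cast hq.ne'
        have h1 : a n z ≤ birkhoffSum (S^[N]) (a N) (n / N) z +
            birkhoffSum S (a 1) N ((S^[N])^[n / N] z) := by
          calc a n z = a (N * (n / N) + n % N) z := by rw [Nat.div_add_mod]
            _ ≤ a (N * (n / N)) z + a (n % N) (S^[N * (n / N)] z) := h.add_le _ _ _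
            _ ≤ _ := by
                gcongr
                · exact h.mul_le_birkhoffSum _ _ _
                · rw [← Function.iterate_mul]
                  refine (h.le_birkhoffSum _ _).trans ?_
                  exact Finset.sum_le_sum_of_subset
                    (Finset.range_mono (Nat.mod_lt n hN).le)
        have h2 : ((N : ℝ≥0∞) * (n / N : ℕ)) ≤ n := by exact_mod_cast Nat.mul_div_le n N
        have h3 : ((N : ℝ≥0∞) * (n / N : ℕ))⁻¹ = (N : ℝ≥0∞)⁻¹ * ((n / N : ℕ) : ℝ≥0∞)⁻¹ :=
          ENNReal.mul_inv (Or.inl hN') (Or.inl (by simp))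
        calc a n z / n ≤ (birkhoffSum (S^[N]) (a N) (n / N) z +
              birkhoffSum S (a 1) N ((S^[N])^[n / N] z)) / ((N : ℝ≥0∞) * (n / N : ℕ)) :=
              ENNReal.div_le_div h1 h2
          _ = u (n / N) := by
              simp only [hu, div_eq_mul_inv, h3]
              ring
    _ ≤ limsup u atTop := by
        rw [show (fun n : ℕ => u (n / N)) = u ∘ (fun n : ℕ => n / N) from rfl,
          limsup_comp]
        exact limsup_le_limsup_of_le hdiv
    _ ≤ _ := by
        refine (ennreal_limsup_add_le _ _).trans ?_
        rw [ENNReal.limsup_const_mul_of_ne_top hNi, ENNReal.limsup_const_mul_of_ne_top hNi]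

theorem lintegral_limsup_le [IsProbabilityMeasure m] (h : IsSubadditiveProcess S a)
    (hS : MeasurePreserving S m m) (h1 : ∫⁻ z, a 1 z ∂m ≠ ∞) {N : ℕ} (hN : 0 < N) :
    ∫⁻ z, limsup (fun n : ℕ => a n z / n) atTop ∂m ≤ (∫⁻ z, a N z ∂m) / N := by
  have hSN := hS.iterate N
  have hbm := measurable_birkhoffSum hS.measurable (h.measurable 1) N
  calc ∫⁻ z, limsup (fun n : ℕ => a n z / n) atTop ∂m ≤ ∫⁻ z,
      ((N : ℝ≥0∞)⁻¹ * limsup (fun q : ℕ => birkhoffSum (S^[N]) (a N) q z / q) atTop +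
      (N : ℝ≥0∞)⁻¹ * limsup (fun q : ℕ => birkhoffSum S (a 1) N ((S^[N])^[q] z) / q) atTop) ∂m :=
        lintegral_mono fun z => h.limsup_div_le hN z
    _ = (N : ℝ≥0∞)⁻¹ * (∫⁻ z, limsup (fun q : ℕ => birkhoffSum (S^[N]) (a N) q z / q) atTop ∂m) +
        (N : ℝ≥0∞)⁻¹ * ∫⁻ z, limsup
          (fun q : ℕ => birkhoffSum S (a 1) N ((S^[N])^[q] z) / q) atTop ∂m := by
        have hm1 : Measurable fun z =>
            limsup (fun q : ℕ => birkhoffSum (S^[N]) (a N) q z / q) atTop :=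
          Measurable.limsup fun q =>
            (measurable_birkhoffSum hSN.measurable (h.measurable N) q).div_const _
        have hm2 : Measurable fun z =>
            limsup (fun q : ℕ => birkhoffSum S (a 1) N ((S^[N])^[q] z) / q) atTop :=
          Measurable.limsup fun q => (hbm.comp (hSN.measurable.iterate q)).div_const _
        rw [lintegral_add_left (hm1.const_mul _), lintegral_const_mul _ hm1,
          lintegral_const_mul _ hm2]
    _ ≤ (N : ℝ≥0∞)⁻¹ * (∫⁻ z, a N z ∂m) + (N : ℝ≥0∞)⁻¹ * 0 := by
        refine add_le_add (mul_le_mul_right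
          (lintegral_limsup_birkhoffSum_le hSN (h.measurable N)) _) (mul_le_mul_right ?_ _)
        refine (lintegral_limsup_comp_iterate_div hSN hbm ?_).le
        rw [lintegral_birkhoffSum hS (h.measurable 1)]
        exact ENNReal.mul_ne_top (by simp) h1
    _ = (∫⁻ z, a N z ∂m) / N := by rw [mul_zero, add_zero, div_eq_mul_inv, mul_comm]

/-- Reverse Fatou needs a dominating function. Cap a_n / n at M; the excess is at most the average
of k = (a_1 - M)⁺, whose integral is ∫ k for every n > 0 and tends to 0 as M → ∞. -/
theorem limsup_lintegral_le [IsProbabilityMeasure m] (h : IsSubadditiveProcess S a)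
    (hS : MeasurePreserving S m m) (h1 : ∫⁻ z, a 1 z ∂m ≠ ∞) :
    limsup (fun n : ℕ => (∫⁻ z, a n z ∂m) / n) atTop ≤
      ∫⁻ z, limsup (fun n : ℕ => a n z / n) atTop ∂m := by
  have key : ∀ M : ℕ, limsup (fun n : ℕ => (∫⁻ z, a n z ∂m) / n) atTop ≤
      ∫⁻ z, limsup (fun n : ℕ => a n z / n) atTop ∂m + ∫⁻ z, (a 1 z - M) ∂m := by
    intro M
    set k : Z → ℝ≥0∞ := fun z => a 1 z - M with hk
    have hkm : Measurable k := (h.measurable 1).sub measurable_const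
    have hpt : ∀ᶠ n : ℕ in atTop, ∀ z, a n z / n ≤ min (a n z / n) M + birkhoffSum S k n z / n := by
      filter_upwards [eventually_gt_atTop 0] with n hn z
      have hn' : (n : ℝ≥0∞) ≠ 0 := by exact_mod_cast hn.ne'
      rw [min_add]
      refine le_min le_self_add ?_
      rw [ENNReal.div_le_iff hn' (by simp), add_mul, ENNReal.div_mul_cancel hn' (by simp)]
      calc a n z ≤ birkhoffSum S (a 1) n z := h.le_birkhoffSum n z
        _ ≤ birkhoffSum S (fun z => (M : ℝ≥0∞) + k z) n z :=
            Finset.sum_le_sum fun j _ => le_add_tsub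
        _ = M * n + birkhoffSum S k n z := by
            simp [birkhoffSum, Finset.sum_add_distrib, mul_comm]
    have hint : ∀ᶠ n : ℕ in atTop, (∫⁻ z, a n z ∂m) / n ≤
        ∫⁻ z, min (a n z / n) M ∂m + ∫⁻ z, k z ∂m := by
      filter_upwards [hpt, eventually_gt_atTop 0] with n hn hn0
      have hn' : (n : ℝ≥0∞) ≠ 0 := by exact_mod_cast hn0.ne'
      calc (∫⁻ z, a n z ∂m) / n = ∫⁻ z, a n z / n ∂m := by
            simp only [div_eq_mul_inv]
            rw [lintegral_mul_const _ (h.measurable n)]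
        _ ≤ ∫⁻ z, (min (a n z / n) M + birkhoffSum S k n z / n) ∂m := lintegral_mono hn
        _ = ∫⁻ z, min (a n z / n) M ∂m + ∫⁻ z, birkhoffSum S k n z / n ∂m :=
            lintegral_add_left (((h.measurable n).div_const _).min measurable_const) _
        _ = ∫⁻ z, min (a n z / n) M ∂m + ∫⁻ z, k z ∂m := by
            congr 1
            simp only [div_eq_mul_inv]
            rw [lintegral_mul_const _ (measurable_birkhoffSum hS.measurable hkm n),
              lintegral_birkhoffSum hS hkm, mul_comm, ← mul_assoc,
              ENNReal.inv_mul_cancel hn' (by simp), one_mul]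
    calc limsup (fun n : ℕ => (∫⁻ z, a n z ∂m) / n) atTop
        ≤ limsup (fun n : ℕ => ∫⁻ z, min (a n z / n) M ∂m + ∫⁻ z, k z ∂m) atTop :=
          limsup_le_limsup hint
      _ ≤ limsup (fun n : ℕ => ∫⁻ z, min (a n z / n) M ∂m) atTop + ∫⁻ z, k z ∂m := by
          refine (ennreal_limsup_add_le _ _).trans ?_
          rw [limsup_const]
      _ ≤ ∫⁻ z, limsup (fun n : ℕ => a n z / n) atTop ∂m + ∫⁻ z, k z ∂m := by
          gcongr
          refine (MeasureTheory.limsup_lintegral_le (fun _ => (M : ℝ≥0∞))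
            (fun n => ((h.measurable n).div_const _).min measurable_const)
            (fun n => ae_of_all _ fun z => min_le_right _ _) (by simp)).trans ?_
          exact lintegral_mono fun z => limsup_le_limsup (Eventually.of_forall fun n =>
            min_le_left _ _)
  have hlim := (tendsto_lintegral_tsub_natCast (h.measurable 1) h1).const_add
    (∫⁻ z, limsup (fun n : ℕ => a n z / n) atTop ∂m)
  rw [add_zero] at hlim
  exact ge_of_tendsto' hlim key

end IsSubadditiveProcess

end Ergodic

/-! ### Differences and truncations in the extended reals -/

section ERealArith

theorem coe_sub_le_coe_sub {a b c d : ℝ≥0∞} (hc : c ≠ ∞) (h : a + d ≤ c + b) :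
    (a : EReal) - b ≤ c - d := by
  induction b with
  | top => simp
  | coe b =>
    lift c to NNReal using hc
    have hd : d ≠ ∞ := fun hd => by simp [hd] at h
    have ha : a ≠ ∞ := fun ha => by simp [ha] at h
    lift a to NNReal using ha
    lift d to NNReal using hd
    have h' : (a : ℝ) + d ≤ c + b := by exact_mod_cast h
    simp only [EReal.coe_nnreal_eq_coe_real]
    norm_cast
    linarith

theorem coe_sub_eq_coe_sub {a b c d : ℝ≥0∞} (ha : a ≠ ∞) (hc : c ≠ ∞) (h : a + d = c + b) :
    (a : EReal) - b = c - d :=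
  le_antisymm (coe_sub_le_coe_sub hc h.le) (coe_sub_le_coe_sub ha h.ge)

theorem toENNReal_coe_sub (a b : ℝ≥0∞) : ((a : EReal) - b).toENNReal = a - b := by
  rw [EReal.toENNReal_sub (EReal.coe_ennreal_nonneg _), EReal.toENNReal_coe, EReal.toENNReal_coe]

theorem toENNReal_neg_coe_sub {a : ℝ≥0∞} (ha : a ≠ ∞) (b : ℝ≥0∞) :
    (-((a : EReal) - b)).toENNReal = b - a := by
  rw [EReal.neg_sub (Or.inl (EReal.coe_ennreal_ne_bot _))
    (Or.inl (by simpa using ha)), add_comm, ← sub_eq_add_neg, toENNReal_coe_sub]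

theorem toENNReal_sub_toENNReal_neg (x : EReal) :
    (x.toENNReal : EReal) - (-x).toENNReal = x := by
  rcases le_total 0 x with h | h
  · rw [EReal.coe_toENNReal h, EReal.toENNReal_of_nonpos (EReal.neg_le_zero.2 h)]; simp
  · rw [EReal.toENNReal_of_nonpos h, EReal.coe_toENNReal (EReal.neg_nonneg.2 h)]; simp

/-- Both ways of writing max(x, -C): as (x + C)⁺ - C and as x⁺ - min(x⁻, C), rearranged so that no
subtraction occurs. -/
theorem toENNReal_add_natCast_add (x : EReal) (C : ℕ) :
    (x + C).toENNReal + min ((-x).toENNReal) C = x.toENNReal + C := by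
  induction x with
  | bot => simp
  | top =>
    have : (⊤ : EReal) + (C : EReal) = ⊤ := EReal.top_add_of_ne_bot (EReal.natCast_ne_bot C)
    simp [this]
  | coe x =>
    have h1 : (x : EReal) + (C : EReal) = ((x + C : ℝ) : EReal) := by norm_cast
    have h2 : (C : ℝ≥0∞) = ENNReal.ofReal C := by simp
    rw [h1, ← EReal.coe_neg, EReal.real_coe_toENNReal, EReal.real_coe_toENNReal,
      EReal.real_coe_toENNReal, h2, ← ENNReal.ofReal_min]
    rcases le_total 0 x with h | h
    · rw [ENNReal.ofReal_of_nonpos (p := min (-x) C) (by simp [h]), add_zero,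
        ENNReal.ofReal_add h (by positivity)]
    · rw [ENNReal.ofReal_of_nonpos h, zero_add]
      rcases le_total (-x) C with h' | h'
      · rw [min_eq_left h', ← ENNReal.ofReal_add (by linarith) (by linarith)]
        congr 1; ring
      · rw [min_eq_right h', ENNReal.ofReal_of_nonpos (by linarith), zero_add]

theorem toENNReal_div_natCast (x : EReal) {n : ℕ} (hn : 0 < n) :
    (x / n).toENNReal = x.toENNReal / n := by
  have hn' : (0 : ℝ) < n := by exact_mod_cast hn
  have hc : (n : EReal) = ((n : ℝ) : EReal) := by norm_cast
  induction x with
  | bot =>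
    rw [hc, EReal.bot_div_of_pos_ne_top (by exact_mod_cast hn') (EReal.coe_ne_top _)]
    simp
  | top =>
    rw [hc, EReal.top_div_of_pos_ne_top (by exact_mod_cast hn') (EReal.coe_ne_top _)]
    simp [ENNReal.top_div_of_ne_top]
  | coe x =>
    rw [hc, ← EReal.coe_div, EReal.real_coe_toENNReal, EReal.real_coe_toENNReal,
      ENNReal.ofReal_div_of_pos hn']
    simp

theorem add_natCast_mul_div (x : EReal) (C : ℕ) {n : ℕ} (hn : 0 < n) :
    (x + (C * n : ℕ)) / n = x / n + C := by
  have hn' : (0 : ℝ) < n := by exact_mod_cast hn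
  have hc : (n : EReal) = ((n : ℝ) : EReal) := by norm_cast
  have hc2 : (C : EReal) = ((C : ℝ) : EReal) := by norm_cast
  have hc3 : ((C * n : ℕ) : EReal) = ((C * n : ℝ) : EReal) := by norm_cast
  rw [hc, hc2, hc3]
  induction x with
  | bot =>
    rw [EReal.bot_add, EReal.bot_div_of_pos_ne_top (by exact_mod_cast hn') (EReal.coe_ne_top _),
      EReal.bot_add]
  | top =>
    rw [EReal.top_add_coe, EReal.top_div_of_pos_ne_top (by exact_mod_cast hn') (EReal.coe_ne_top _),
      EReal.top_add_coe]
  | coe x =>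
    rw [← EReal.coe_add, ← EReal.coe_div, ← EReal.coe_div, ← EReal.coe_add]
    congr 1
    field_simp

theorem tendsto_coe_div_natCast (c : ℝ) :
    Tendsto (fun n : ℕ => (c : EReal) / n) atTop (𝓝 0) := by
  have : Tendsto (fun n : ℕ => ((c / n : ℝ) : EReal)) atTop (𝓝 ((0 : ℝ) : EReal)) :=
    EReal.tendsto_coe.2 (tendsto_const_div_atTop_nhds_zero_nat c)
  simpa [EReal.coe_div] using this

theorem neg_div_natCast (x : EReal) (n : ℕ) : -x / n = -(x / n) := by
  rw [div_eq_mul_inv, div_eq_mul_inv, EReal.neg_mul]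

theorem sub_div_natCast (x y : EReal) (n : ℕ) : (x - y) / n = x / n - y / n := by
  rw [sub_eq_add_neg, EReal.add_div_of_nonneg_right (Nat.cast_nonneg' n), sub_eq_add_neg,
    neg_div_natCast]

theorem coe_div_natCast (a : ℝ≥0∞) {n : ℕ} (hn : 0 < n) :
    ((a / n : ℝ≥0∞) : EReal) = (a : EReal) / n := by
  have h := toENNReal_div_natCast (a : EReal) hn
  rw [EReal.toENNReal_coe] at h
  rw [← h, EReal.coe_toENNReal (EReal.div_nonneg (EReal.coe_ennreal_nonneg _) (Nat.cast_nonneg' n))]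

end ERealArith

/-! ### The extended integral and its truncations -/

section Eintegral

variable {α : Type*} [MeasurableSpace α] {μ : Measure α}

theorem aemeasurable_neg_toENNReal {h : α → EReal} (hh : AEMeasurable h μ) :
    AEMeasurable (fun x => (-h x).toENNReal) μ := hh.neg.ereal_toENNReal

theorem eintegral_mono_ae {h g : α → EReal} (hle : ∀ᵐ x ∂μ, h x ≤ g x) :
    eintegral μ h ≤ eintegral μ g := by
  refine EReal.sub_le_sub (EReal.coe_ennreal_le_coe_ennreal_iff.2 (lintegral_mono_ae ?_))
    (EReal.coe_ennreal_le_coe_ennreal_iff.2 (lintegral_mono_ae ?_))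
  · filter_upwards [hle] with x hx using EReal.toENNReal_le_toENNReal hx
  · filter_upwards [hle] with x hx using EReal.toENNReal_le_toENNReal (EReal.neg_le_neg_iff.2 hx)

/-- Any decomposition with finite ∫ a computes the integral, not only the one into positive and
negative parts, since (a - b)⁺ + b = max(a, b) = a + (b - a)⁺. Additivity and Fubini rest on this.
-/
theorem eintegral_coe_sub {a b : α → ℝ≥0∞} (ha : AEMeasurable a μ) (hb : AEMeasurable b μ)
    (hai : ∫⁻ x, a x ∂μ ≠ ∞) :
    eintegral μ (fun x => (a x : EReal) - b x) =
      (∫⁻ x, a x ∂μ : ℝ≥0∞) - (∫⁻ x, b x ∂μ : ℝ≥0∞) := by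
  have hneg : ∫⁻ x, (-((a x : EReal) - b x)).toENNReal ∂μ = ∫⁻ x, (b x - a x) ∂μ := by
    refine lintegral_congr_ae ?_
    filter_upwards [ae_lt_top' ha hai] with x hx using toENNReal_neg_coe_sub hx.ne _
  simp only [eintegral, hneg, toENNReal_coe_sub]
  refine coe_sub_eq_coe_sub (ne_top_of_le_ne_top hai (lintegral_mono fun x => tsub_le_self)) hai ?_
  rw [← lintegral_add_right' _ hb, ← lintegral_add_left' ha]
  exact lintegral_congr fun x => tsub_add_eq_max.trans add_tsub_eq_max.symm

theorem quasiIntegrable_coe_sub {a b : α → ℝ≥0∞} (ha : AEMeasurable a μ) (hb : AEMeasurable b μ)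
    (hai : ∫⁻ x, a x ∂μ ≠ ∞) : QuasiIntegrable μ (fun x => (a x : EReal) - b x) := by
  refine ⟨?_, ?_⟩
  · simp only [sub_eq_add_neg]
    exact (measurable_coe_ennreal_ereal.comp_aemeasurable ha).add
      (measurable_coe_ennreal_ereal.comp_aemeasurable hb).neg
  · simp only [toENNReal_coe_sub]
    exact (lintegral_mono fun x => tsub_le_self).trans_lt hai.lt_top

theorem QuasiIntegrable.mono {h g : α → EReal} (hg : QuasiIntegrable μ g) (hm : AEMeasurable h μ)
    (hle : ∀ᵐ x ∂μ, h x ≤ g x) : QuasiIntegrable μ h :=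
  ⟨hm, (lintegral_mono_ae (hle.mono fun _ hx => EReal.toENNReal_le_toENNReal hx)).trans_lt hg.2⟩

theorem QuasiIntegrable.eintegral_lt_top {h : α → EReal} (hh : QuasiIntegrable μ h) :
    eintegral μ h < ⊤ := by
  refine lt_of_le_of_lt (EReal.sub_le_sub le_rfl (EReal.coe_ennreal_nonneg _)) ?_
  simpa [lt_top_iff_ne_top] using hh.2

theorem QuasiIntegrable.eintegral_sub_const [IsProbabilityMeasure μ] {h : α → EReal}
    (hh : QuasiIntegrable μ h) (c : NNReal) :
    eintegral μ (fun x => h x - ((c : ℝ) : EReal)) = eintegral μ h - ((c : ℝ) : EReal) := by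
  have e : ∀ a b : ℝ≥0∞, (a : EReal) - b - ((c : ℝ) : EReal) = a - ((b + c : ℝ≥0∞) : EReal) := by
    intro a b
    rw [EReal.coe_ennreal_add, EReal.coe_nnreal_eq_coe_real,
      sub_eq_add_neg, sub_eq_add_neg, sub_eq_add_neg, EReal.neg_add (by simp) (by simp), add_assoc,
      sub_eq_add_neg]
  calc eintegral μ (fun x => h x - ((c : ℝ) : EReal))
      = eintegral μ (fun x => ((h x).toENNReal : EReal) - ((-h x).toENNReal + c : ℝ≥0∞)) := by
        congr 1
        funext x
        rw [← e, toENNReal_sub_toENNReal_neg]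
    _ = _ := by
        rw [eintegral_coe_sub hh.1.ereal_toENNReal
          ((aemeasurable_neg_toENNReal hh.1).add_const _) hh.2.ne,
          lintegral_add_right _ measurable_const, lintegral_const, measure_univ, mul_one, ← e]
        rfl

theorem eintegral_add {h g : α → EReal} (hh : QuasiIntegrable μ h) (hg : QuasiIntegrable μ g) :
    eintegral μ (fun x => h x + g x) = eintegral μ h + eintegral μ g ∧
      QuasiIntegrable μ (fun x => h x + g x) := by
  have e : ∀ a b c d : ℝ≥0∞, ((a + b : ℝ≥0∞) : EReal) - (c + d : ℝ≥0∞) =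
      ((a : EReal) - c) + (b - d) := fun a b c d => by
    rw [EReal.coe_ennreal_add, EReal.coe_ennreal_add, EReal.add_sub_add_comm (by simp) (by simp)]
  have hfun : (fun x => h x + g x) = fun x => (((h x).toENNReal + (g x).toENNReal : ℝ≥0∞) : EReal) -
      ((-h x).toENNReal + (-g x).toENNReal : ℝ≥0∞) := by
    funext x
    rw [e, toENNReal_sub_toENNReal_neg, toENNReal_sub_toENNReal_neg]
  have hp : AEMeasurable (fun x => (h x).toENNReal + (g x).toENNReal) μ :=
    hh.1.ereal_toENNReal.add hg.1.ereal_toENNReal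
  have hn : AEMeasurable (fun x => (-h x).toENNReal + (-g x).toENNReal) μ :=
    (aemeasurable_neg_toENNReal hh.1).add (aemeasurable_neg_toENNReal hg.1)
  have hfin : ∫⁻ x, ((h x).toENNReal + (g x).toENNReal) ∂μ ≠ ∞ := by
    rw [lintegral_add_left' hh.1.ereal_toENNReal]
    exact ENNReal.add_ne_top.2 ⟨hh.2.ne, hg.2.ne⟩
  rw [hfun]
  refine ⟨?_, quasiIntegrable_coe_sub hp hn hfin⟩
  rw [eintegral_coe_sub hp hn hfin, lintegral_add_left' hh.1.ereal_toENNReal,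
    lintegral_add_left' (aemeasurable_neg_toENNReal hh.1), e]
  rfl

theorem eintegral_div_natCast (h : α → EReal) {n : ℕ} (hn : 0 < n) :
    eintegral μ (fun x => h x / n) = eintegral μ h / n := by
  have hinv : ((n : ℝ≥0∞)⁻¹) ≠ ∞ := by simp [hn.ne']
  have hdiv : ∀ f : α → ℝ≥0∞, ∫⁻ x, f x / n ∂μ = (∫⁻ x, f x ∂μ) / n := fun f => by
    simp only [div_eq_mul_inv]
    exact lintegral_mul_const' _ _ hinv
  simp only [eintegral, ← neg_div_natCast, toENNReal_div_natCast _ hn, hdiv, coe_div_natCast _ hn,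
    sub_div_natCast]

/-- Each side is the integral of max(h, -C). The left form suits the nonnegative Kingman theorem;
the right form makes monotonicity and convergence in C visible. -/
theorem lintegral_toENNReal_add_natCast [IsProbabilityMeasure μ] {h : α → EReal}
    (hh : QuasiIntegrable μ h) (C : ℕ) :
    ((∫⁻ x, (h x + C).toENNReal ∂μ : ℝ≥0∞) : EReal) - C =
      (∫⁻ x, (h x).toENNReal ∂μ : ℝ≥0∞) - (∫⁻ x, min (-h x).toENNReal C ∂μ : ℝ≥0∞) := by
  have key : ∫⁻ x, (h x + C).toENNReal ∂μ + ∫⁻ x, min (-h x).toENNReal C ∂μ =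
      ∫⁻ x, (h x).toENNReal ∂μ + C := by
    rw [← lintegral_add_right' _ ((aemeasurable_neg_toENNReal hh.1).min aemeasurable_const)]
    rw [lintegral_congr fun x => toENNReal_add_natCast_add (h x) C]
    rw [lintegral_add_right _ measurable_const]
    simp
  have : (C : EReal) = ((C : ℝ≥0∞) : EReal) := by norm_cast
  rw [this]
  refine coe_sub_eq_coe_sub ?_ hh.2.ne key
  exact ne_top_of_le_ne_top (ENNReal.add_ne_top.2 ⟨hh.2.ne, ENNReal.natCast_ne_top C⟩)
    (key ▸ le_self_add)

theorem QuasiIntegrable.eintegral_le_trunc [IsProbabilityMeasure μ] {h : α → EReal}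
    (hh : QuasiIntegrable μ h) (C : ℕ) :
    eintegral μ h ≤ ((∫⁻ x, (h x + C).toENNReal ∂μ : ℝ≥0∞) : EReal) - C := by
  rw [lintegral_toENNReal_add_natCast hh C]
  exact EReal.sub_le_sub le_rfl (EReal.coe_ennreal_le_coe_ennreal_iff.2
    (lintegral_mono fun x => min_le_left _ _))

theorem QuasiIntegrable.antitone_trunc [IsProbabilityMeasure μ] {h : α → EReal}
    (hh : QuasiIntegrable μ h) :
    Antitone fun C : ℕ => ((∫⁻ x, (h x + C).toENNReal ∂μ : ℝ≥0∞) : EReal) - C := by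
  intro a b hab
  simp only [lintegral_toENNReal_add_natCast hh]
  exact EReal.sub_le_sub le_rfl (EReal.coe_ennreal_le_coe_ennreal_iff.2
    (lintegral_mono fun x => min_le_min_left _ (by exact_mod_cast hab)))

theorem QuasiIntegrable.tendsto_trunc [IsProbabilityMeasure μ] {h : α → EReal}
    (hh : QuasiIntegrable μ h) :
    Tendsto (fun C : ℕ => ((∫⁻ x, (h x + C).toENNReal ∂μ : ℝ≥0∞) : EReal) - C) atTop
      (𝓝 (eintegral μ h)) := by
  simp only [lintegral_toENNReal_add_natCast hh]
  have h1 : Tendsto (fun C : ℕ => ∫⁻ x, min (-h x).toENNReal C ∂μ) atTop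
      (𝓝 (∫⁻ x, (-h x).toENNReal ∂μ)) := by
    refine lintegral_tendsto_of_tendsto_of_monotone
      (fun C => (aemeasurable_neg_toENNReal hh.1).min aemeasurable_const)
      (ae_of_all _ fun x a b hab => min_le_min_left _ (by exact_mod_cast hab))
      (ae_of_all _ fun x => ?_)
    have := (tendsto_const_nhds (x := (-h x).toENNReal)).min ENNReal.tendsto_nat_nhds_top
    simpa using this
  have h2 := (continuous_coe_ennreal_ereal.tendsto _).comp h1
  have h3 := (continuous_neg.tendsto _).comp h2
  have h4 := Tendsto.comp (EReal.continuousAt_add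
    (p := ((∫⁻ x, (h x).toENNReal ∂μ : ℝ≥0∞), -((∫⁻ x, (-h x).toENNReal ∂μ : ℝ≥0∞) : EReal)))
    (Or.inl (by simpa using hh.2.ne)) (Or.inl (EReal.coe_ennreal_ne_bot _)))
    (tendsto_const_nhds.prodMk_nhds h3)
  exact h4

theorem QuasiIntegrable.eintegral_eq_iInf_trunc [IsProbabilityMeasure μ] {h : α → EReal}
    (hh : QuasiIntegrable μ h) :
    eintegral μ h = ⨅ C : ℕ, ((∫⁻ x, (h x + C).toENNReal ∂μ : ℝ≥0∞) : EReal) - C :=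
  tendsto_nhds_unique hh.tendsto_trunc (tendsto_atTop_iInf hh.antitone_trunc)

/-- Fubini's theorem for extended real functions with integrable positive part. -/
theorem eintegral_prod {β : Type*} [MeasurableSpace β] {ν : Measure β} [SFinite μ] [SFinite ν]
    {h : β × α → EReal} (hm : Measurable h) (hh : QuasiIntegrable (ν.prod μ) h) :
    eintegral μ (fun x => eintegral ν (fun y => h (y, x))) = eintegral (ν.prod μ) h ∧
      QuasiIntegrable μ (fun x => eintegral ν (fun y => h (y, x))) ∧
      ∀ᵐ x ∂μ, QuasiIntegrable ν (fun y => h (y, x)) := by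
  have hp := hm.ereal_toENNReal
  have hn : Measurable fun z => (-h z).toENNReal := hm.neg.ereal_toENNReal
  have e1 : ∫⁻ z, (h z).toENNReal ∂(ν.prod μ) = ∫⁻ x, ∫⁻ y, (h (y, x)).toENNReal ∂ν ∂μ :=
    lintegral_prod_symm _ hp.aemeasurable
  have e2 : ∫⁻ z, (-h z).toENNReal ∂(ν.prod μ) = ∫⁻ x, ∫⁻ y, (-h (y, x)).toENNReal ∂ν ∂μ :=
    lintegral_prod_symm _ hn.aemeasurable
  have hfin : ∫⁻ x, ∫⁻ y, (h (y, x)).toENNReal ∂ν ∂μ ≠ ∞ := e1 ▸ hh.2.ne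
  have m1 : Measurable fun x => ∫⁻ y, (h (y, x)).toENNReal ∂ν := hp.lintegral_prod_left'
  have m2 : Measurable fun x => ∫⁻ y, (-h (y, x)).toENNReal ∂ν := hn.lintegral_prod_left'
  refine ⟨?_, quasiIntegrable_coe_sub m1.aemeasurable m2.aemeasurable hfin, ?_⟩
  · rw [eintegral.eq_def (ν.prod μ), e1, e2]
    exact eintegral_coe_sub m1.aemeasurable m2.aemeasurable hfin
  · filter_upwards [ae_lt_top m1 hfin] with x hx
    exact ⟨(hm.comp measurable_prodMk_right).aemeasurable, hx⟩

end Eintegral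

/-! ### Kingman's theorem in the mean for processes reaching -∞ -/

section Kingman

theorem continuous_add_natCast (C : ℕ) : Continuous fun x : EReal => x + C := by
  refine continuous_iff_continuousAt.2 fun x => ?_
  have hC : (C : EReal) = ((C : ℝ) : EReal) := by norm_cast
  rw [hC]
  exact Tendsto.comp (EReal.continuousAt_add (p := (x, ((C : ℝ) : EReal)))
    (Or.inr (EReal.coe_ne_bot _)) (Or.inr (EReal.coe_ne_top _)))
    (tendsto_id.prodMk_nhds tendsto_const_nhds)

theorem continuous_sub_coe (c : ℝ) : Continuous fun x : EReal => x - c := by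
  refine continuous_iff_continuousAt.2 fun x => ?_
  simp only [sub_eq_add_neg, ← EReal.coe_neg]
  exact Tendsto.comp (EReal.continuousAt_add (p := (x, ((-c : ℝ) : EReal)))
    (Or.inr (EReal.coe_ne_bot _)) (Or.inr (EReal.coe_ne_top _)))
    (tendsto_id.prodMk_nhds tendsto_const_nhds)

theorem limsup_toENNReal_add_natCast (u : ℕ → EReal) (C : ℕ) :
    limsup (fun n => (u n + C).toENNReal) atTop = (limsup u atTop + C).toENNReal :=
  (Monotone.map_limsup_of_continuousAt (f := fun x : EReal => (x + C).toENNReal)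
    (fun x y hxy => EReal.toENNReal_le_toENNReal (by gcongr)) u
    (EReal.continuous_toENNReal.comp (continuous_add_natCast C)).continuousAt
    (by isBoundedDefault) (by isBoundedDefault)).symm

variable {Z : Type*} [MeasurableSpace Z] {m : Measure Z} [IsProbabilityMeasure m] {S : Z → Z}

theorem isSubadditiveProcess_toENNReal {φ : ℕ → Z → EReal}
    (hm : ∀ n, Measurable (φ n)) (h0 : ∀ z, φ 0 z = 0)
    (hadd : ∀ n k z, φ (n + k) z ≤ φ n z + φ k (S^[n] z)) (C : ℕ) :
    IsSubadditiveProcess S (fun n z => (φ n z + (C * n : ℕ)).toENNReal) where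
  measurable n := ((hm n).add_const _).ereal_toENNReal
  zero z := by simp [h0]
  add_le n k z := by
    refine le_trans (EReal.toENNReal_le_toENNReal ?_) EReal.toENNReal_add_le
    calc φ (n + k) z + (C * (n + k) : ℕ)
        ≤ (φ n z + φ k (S^[n] z)) + ((C * n : ℕ) + (C * k : ℕ)) := by
          rw [mul_add, Nat.cast_add]
          gcongr
          exact hadd n k z
      _ = _ := add_add_add_comm _ _ _ _

/-- Kingman's subadditive ergodic theorem in the mean, for processes that may take the value `-∞`:
the normalized integrals converge to the integral of the upper growth rate. -/
theorem tendsto_eintegral_div_of_subadditive (hS : MeasurePreserving S m m) {φ : ℕ → Z → EReal}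
    (hm : ∀ n, Measurable (φ n)) (h0 : ∀ z, φ 0 z = 0)
    (hadd : ∀ n k z, φ (n + k) z ≤ φ n z + φ k (S^[n] z))
    (h1 : ∫⁻ z, (φ 1 z).toENNReal ∂m ≠ ∞) :
    (∀ n, QuasiIntegrable m (φ n)) ∧
      QuasiIntegrable m (fun z => limsup (fun n : ℕ => φ n z / n) atTop) ∧
      Tendsto (fun n : ℕ => eintegral m (φ n) / n) atTop
        (𝓝 (eintegral m (fun z => limsup (fun n : ℕ => φ n z / n) atTop))) := by
  set φlim : Z → EReal := fun z => limsup (fun n : ℕ => φ n z / n) atTop with hφlim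
  have hsub := isSubadditiveProcess_toENNReal hm h0 hadd
  have hdm : ∀ n : ℕ, Measurable fun z => φ n z / n := fun n => by
    simp only [div_eq_mul_inv]; exact (hm n).mul_const _
  have hlm : Measurable φlim := Measurable.limsup hdm
  have h1C : ∀ C : ℕ, ∫⁻ z, (φ 1 z + (C * 1 : ℕ)).toENNReal ∂m ≠ ∞ := fun C => by
    refine ne_top_of_le_ne_top (b := ∫⁻ z, (φ 1 z).toENNReal ∂m + C)
      (ENNReal.add_ne_top.2 ⟨h1, ENNReal.natCast_ne_top C⟩) ?_
    calc ∫⁻ z, (φ 1 z + (C * 1 : ℕ)).toENNReal ∂m ≤ ∫⁻ z, ((φ 1 z).toENNReal + C) ∂m := by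
          refine lintegral_mono fun z => ?_
          rw [← toENNReal_add_natCast_add, mul_one]
          exact le_self_add
      _ = ∫⁻ z, (φ 1 z).toENNReal ∂m + C := by
          rw [lintegral_add_right _ measurable_const]; simp
  have hdiv : ∀ (C : ℕ) {n : ℕ}, 0 < n → ∀ z,
      (φ n z + (C * n : ℕ)).toENNReal / n = (φ n z / n + C).toENNReal := fun C n hn z => by
    rw [← toENNReal_div_natCast _ hn, add_natCast_mul_div _ _ hn]
  have hint : ∀ (C : ℕ) {n : ℕ}, 0 < n → (∫⁻ z, (φ n z + (C * n : ℕ)).toENNReal ∂m) / n =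
      ∫⁻ z, (φ n z / n + C).toENNReal ∂m := fun C n hn => by
    rw [← lintegral_congr (hdiv C hn)]
    simp only [div_eq_mul_inv]
    exact (lintegral_mul_const' _ _ (by simp [hn.ne'])).symm
  have hlim : ∀ (C : ℕ) (z : Z),
      limsup (fun n : ℕ => (φ n z + (C * n : ℕ)).toENNReal / n) atTop =
        (φlim z + C).toENNReal := fun C z => by
    rw [← limsup_toENNReal_add_natCast]
    exact limsup_congr ((eventually_gt_atTop 0).mono fun n hn => hdiv C hn z)
  -- For each fixed C, `hle` and `hge` are the two halves of the nonnegative theorem, read through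
  -- (φ_n + Cn)⁺ / n = (φ_n / n + C)⁺.
  have hle : ∀ (C : ℕ) {n : ℕ}, 0 < n →
      ∫⁻ z, (φlim z + C).toENNReal ∂m ≤ ∫⁻ z, (φ n z / n + C).toENNReal ∂m := fun C n hn => by
    rw [← hint C hn, ← lintegral_congr (hlim C)]
    exact (hsub C).lintegral_limsup_le hS (h1C C) hn
  have hge : ∀ C : ℕ, limsup (fun n : ℕ => ∫⁻ z, (φ n z / n + C).toENNReal ∂m) atTop ≤
      ∫⁻ z, (φlim z + C).toENNReal ∂m := fun C => by
    rw [← lintegral_congr (hlim C)]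
    refine le_trans (le_of_eq ?_) ((hsub C).limsup_lintegral_le hS (h1C C))
    exact limsup_congr ((eventually_gt_atTop 0).mono fun n hn => (hint C hn).symm)
  have hquasi : ∀ n, QuasiIntegrable m (φ n) := fun n => by
    refine ⟨(hm n).aemeasurable, ?_⟩
    have h := (hsub 0).lintegral_le hS n
    simp only [zero_mul, Nat.cast_zero, add_zero] at h
    exact h.trans_lt (ENNReal.mul_lt_top (by simp) h1.lt_top)
  have hquasi' : ∀ n, 0 < n → QuasiIntegrable m (fun z => φ n z / n) := fun n hn => by
    refine ⟨(hdm n).aemeasurable, ?_⟩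
    have h := hint 0 hn
    simp only [zero_mul, Nat.cast_zero, add_zero] at h
    rw [← h]
    exact ENNReal.div_lt_top (hquasi n).2.ne (by simp [hn.ne'])
  have hlquasi : QuasiIntegrable m φlim := by
    refine ⟨hlm.aemeasurable, ?_⟩
    have h := hle 0 one_pos
    simp only [Nat.cast_zero, add_zero] at h
    exact h.trans_lt (hquasi' 1 one_pos).2
  refine ⟨hquasi, hlquasi, ?_⟩
  have hev : (fun n : ℕ => eintegral m (fun z => φ n z / n)) =ᶠ[atTop]
      fun n : ℕ => eintegral m (φ n) / n :=
    (eventually_gt_atTop 0).mono fun n hn => eintegral_div_natCast _ hn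
  refine Tendsto.congr' hev (tendsto_order.2 ⟨fun b hb => ?_, fun b hb => ?_⟩)
  -- Lower bound: fix n and let C → ∞ in `hle`.
  · filter_upwards [eventually_gt_atTop 0] with n hn
    refine hb.trans_le (ge_of_tendsto' (hquasi' n hn).tendsto_trunc fun C => ?_)
    exact (hlquasi.eintegral_le_trunc C).trans
      (EReal.sub_le_sub (EReal.coe_ennreal_le_coe_ennreal_iff.2 (hle C hn)) le_rfl)
  -- Upper bound: fix C for which the truncated integral of the limit is already below b, then let n
  -- → ∞ in `hge`; truncation only increases the integrals.
  · obtain ⟨C, hC⟩ := (hlquasi.tendsto_trunc.eventually_lt_const hb).exists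
    have hCr : (C : EReal) = ((C : ℝ) : EReal) := by norm_cast
    have hmono : Monotone fun x : ℝ≥0∞ => (x : EReal) - C := fun x y hxy =>
      EReal.sub_le_sub (EReal.coe_ennreal_le_coe_ennreal_iff.2 hxy) le_rfl
    have hcont : Continuous fun x : ℝ≥0∞ => (x : EReal) - C := by
      rw [hCr]
      exact (continuous_sub_coe C).comp continuous_coe_ennreal_ereal
    have hlt := (hmono (hge C)).trans_lt hC
    replace hlt := (hmono.map_limsup_of_continuousAt _ hcont.continuousAt
      (by isBoundedDefault) (by isBoundedDefault)).symm.trans_lt hlt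
    filter_upwards [eventually_lt_of_limsup_lt hlt, eventually_gt_atTop 0] with n hn hn0
    exact ((hquasi' n hn0).eintegral_le_trunc C).trans_lt hn

end Kingman

/-! ### Extended logarithms of operator norms -/

section Elog

theorem elog_mono {r s : ℝ} (h : r ≤ s) : elog r ≤ elog s :=
  ENNReal.log_monotone (ENNReal.ofReal_le_ofReal h)

theorem continuous_elog : Continuous elog :=
  ENNReal.continuous_log.comp ENNReal.continuous_ofReal

theorem elog_of_pos {r : ℝ} (h : 0 < r) : elog r = Real.log r :=
  ENNReal.log_ofReal_of_pos h

theorem elog_zero : elog 0 = ⊥ := by simp [elog]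

theorem elog_one : elog 1 = 0 := by simp [elog]

theorem elog_ne_top (r : ℝ) : elog r ≠ ⊤ := by
  rw [elog, Ne, ENNReal.log_eq_top_iff]
  exact ENNReal.ofReal_ne_top

theorem elog_mul {r s : ℝ} (hr : 0 ≤ r) : elog (r * s) = elog r + elog s := by
  rw [elog, ENNReal.ofReal_mul hr, ENNReal.log_mul_add]
  rfl

theorem toENNReal_elog (r : ℝ) (hr : 0 ≤ r) :
    (elog r).toENNReal = ENNReal.ofReal (Real.posLog r) := by
  rcases hr.eq_or_lt with rfl | hr
  · simp [elog_zero]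
  · rw [elog_of_pos hr, EReal.real_coe_toENNReal, Real.posLog_apply, ENNReal.ofReal_max]
    simp

variable {V W : Type*} [NormedAddCommGroup V] [NormedSpace ℝ V] [FiniteDimensional ℝ V]
  [NormedAddCommGroup W] [NormedSpace ℝ W]

/-- The exponential of the supremum is an operator bound for A. This also covers A = 0 and V = 0,
where both sides are `⊥`. -/
theorem iSup_elog_div_eq_elog_norm (A : V →ₗ[ℝ] W) :
    ⨆ v : {v : V // v ≠ 0}, elog (‖A v‖ / ‖(v : V)‖) = elog ‖A.toContinuousLinearMap‖ := by
  refine le_antisymm (iSup_le fun v => elog_mono ?_) ?_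
  · exact A.toContinuousLinearMap.ratio_le_opNorm v
  · set s := ⨆ v : {v : V // v ≠ 0}, elog (‖A v‖ / ‖(v : V)‖) with hs
    by_cases hst : s = ⊤
    · simp [hst]
    have hc : EReal.exp s ≠ ∞ := by
      intro h
      have := congrArg ENNReal.log h
      simp [hst] at this
    have hb : ‖A.toContinuousLinearMap‖ ≤ (EReal.exp s).toReal := by
      refine ContinuousLinearMap.opNorm_le_bound _ ENNReal.toReal_nonneg fun v => ?_
      by_cases hv : v = 0
      · simp [hv]
      have h1 : elog (‖A v‖ / ‖v‖) ≤ s := le_iSup (fun v : {v : V // v ≠ 0} =>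
        elog (‖A v‖ / ‖(v : V)‖)) ⟨v, hv⟩
      have h2 : ENNReal.ofReal (‖A v‖ / ‖v‖) ≤ EReal.exp s := by
        rw [← ENNReal.log_le_log_iff, EReal.log_exp]
        exact h1
      have h3 := (ENNReal.ofReal_le_iff_le_toReal hc).1 h2
      exact (div_le_iff₀ (norm_pos_iff.2 hv)).1 h3
    calc elog ‖A.toContinuousLinearMap‖ ≤ elog (EReal.exp s).toReal := elog_mono hb
      _ = s := by rw [elog, ENNReal.ofReal_toReal hc, EReal.log_exp]

theorem elog_div_le_elog_norm (A : V →ₗ[ℝ] W) (v : V) :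
    elog (‖A v‖ / ‖v‖) ≤ elog ‖A.toContinuousLinearMap‖ :=
  elog_mono (A.toContinuousLinearMap.ratio_le_opNorm v)

theorem elog_norm_comp_le {U : Type*} [NormedAddCommGroup U] [NormedSpace ℝ U]
    [FiniteDimensional ℝ U] (A : V →ₗ[ℝ] W) (B : U →ₗ[ℝ] V) :
    elog ‖(A ∘ₗ B).toContinuousLinearMap‖ ≤
      elog ‖B.toContinuousLinearMap‖ + elog ‖A.toContinuousLinearMap‖ := by
  rw [add_comm, ← elog_mul (norm_nonneg _)]
  exact elog_mono (ContinuousLinearMap.opNorm_comp_le A.toContinuousLinearMap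
    B.toContinuousLinearMap)

end Elog

/-! ### Norms of exterior powers -/

section ExteriorNorm

open RealInnerProductSpace

variable {V W : Type*} [NormedAddCommGroup V] [InnerProductSpace ℝ V] [FiniteDimensional ℝ V]
  [NormedAddCommGroup W] [InnerProductSpace ℝ W] [FiniteDimensional ℝ W]

theorem norm_le_of_abs_inner_le {ι κ : Type*} [Fintype ι] [Fintype κ] (b : OrthonormalBasis ι ℝ V)
    (c : OrthonormalBasis κ ℝ W) (A : V →ₗ[ℝ] W) {K : ℝ} (hK : 0 ≤ K)
    (h : ∀ i j, |⟪c j, A (b i)⟫| ≤ K) :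
    ‖A.toContinuousLinearMap‖ ≤ Fintype.card ι * (Fintype.card κ * K) := by
  refine ContinuousLinearMap.opNorm_le_bound _ (by positivity) fun v => ?_
  have hcol : ∀ i, ‖A (b i)‖ ≤ Fintype.card κ * K := fun i => by
    conv_lhs => rw [← c.sum_repr' (A (b i))]
    refine (norm_sum_le _ _).trans ?_
    calc ∑ j, ‖⟪c j, A (b i)⟫ • c j‖ ≤ ∑ _j : κ, K := by
          refine Finset.sum_le_sum fun j _ => ?_
          rw [norm_smul, c.norm_eq_one, mul_one]
          exact h i j
      _ = Fintype.card κ * K := by simp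
  calc ‖A.toContinuousLinearMap v‖ = ‖A (∑ i, ⟪b i, v⟫ • b i)‖ := by rw [b.sum_repr' v]; rfl
    _ = ‖∑ i, ⟪b i, v⟫ • A (b i)‖ := by simp
    _ ≤ ∑ i, ‖⟪b i, v⟫ • A (b i)‖ := norm_sum_le _ _
    _ ≤ ∑ _i : ι, ‖v‖ * (Fintype.card κ * K) := by
        refine Finset.sum_le_sum fun i _ => ?_
        rw [norm_smul]
        refine mul_le_mul ?_ (hcol i) (norm_nonneg _) (norm_nonneg _)
        simpa using norm_inner_le_norm (𝕜 := ℝ) (b i) v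
    _ = Fintype.card ι * (Fintype.card κ * K) * ‖v‖ := by
        simp only [Finset.sum_const, Finset.card_univ, nsmul_eq_mul]
        ring

theorem elog_norm_exteriorPower_map_comp_le {U : Type*} [NormedAddCommGroup U]
    [InnerProductSpace ℝ U] [FiniteDimensional ℝ U] (k : ℕ) (A : V →ₗ[ℝ] W) (B : U →ₗ[ℝ] V) :
    elog ‖(exteriorPower.map k (A ∘ₗ B)).toContinuousLinearMap‖ ≤
      elog ‖(exteriorPower.map k B).toContinuousLinearMap‖ +
        elog ‖(exteriorPower.map k A).toContinuousLinearMap‖ := by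
  have h : exteriorPower.map k (A ∘ₗ B) = exteriorPower.map k A ∘ₗ exteriorPower.map k B :=
    exteriorPower.map_comp B A
  rw [h]
  exact elog_norm_comp_le _ _

theorem norm_ιMulti_of_orthonormal {n : ℕ} {v : Fin n → V} (hv : Orthonormal ℝ v) :
    ‖exteriorPower.ιMulti ℝ n v‖ = 1 := by
  have h := exteriorPower.inner_ιMulti_self v
  rw [Matrix.gram_eq_one_iff_orthonormal.2 hv, Matrix.det_one, real_inner_self_eq_norm_sq] at h
  exact (pow_eq_one_iff_of_nonneg (norm_nonneg _) two_ne_zero).1 h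

/-- In orthonormal bases the coefficients of ∧^{i+1}A are minors. Laplace expansion along the first
row leaves entries bounded by ‖A‖ times minors that are coefficients of ∧^i A between unit vectors.
A crude dimensional constant is enough, as it disappears after division by n. -/
theorem exists_norm_exteriorPower_map_succ_le (d i : ℕ) : ∃ C : ℝ, 0 ≤ C ∧
    ∀ {V W : Type*} [NormedAddCommGroup V] [InnerProductSpace ℝ V] [FiniteDimensional ℝ V]
      [NormedAddCommGroup W] [InnerProductSpace ℝ W] [FiniteDimensional ℝ W]
      (_ : Module.finrank ℝ V = d) (_ : Module.finrank ℝ W = d) (A : V →ₗ[ℝ] W),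
      ‖(exteriorPower.map (i + 1) A).toContinuousLinearMap‖ ≤
        C * (‖(exteriorPower.map i A).toContinuousLinearMap‖ * ‖A.toContinuousLinearMap‖) := by
  set n := Fintype.card (Set.powersetCard (Fin d) (i + 1)) with hn
  refine ⟨n * (n * (i + 1)), by positivity, ?_⟩
  intro V W _ _ _ _ _ _ hV hW A
  set b := (stdOrthonormalBasis ℝ V).reindex (finCongr hV) with hb
  set c := (stdOrthonormalBasis ℝ W).reindex (finCongr hW) with hc
  set K := ‖(exteriorPower.map i A).toContinuousLinearMap‖ * ‖A.toContinuousLinearMap‖ with hK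
  have hK0 : 0 ≤ K := by positivity
  have key : ∀ I J : Set.powersetCard (Fin d) (i + 1),
      |⟪(c.exteriorPower (i + 1)) J, exteriorPower.map (i + 1) A ((b.exteriorPower (i + 1)) I)⟫| ≤
        (i + 1) * K := by
    intro I J
    set x : Fin (i + 1) → Fin d := ⇑(Set.powersetCard.ofFinEmbEquiv.symm I) with hx
    set y : Fin (i + 1) → Fin d := ⇑(Set.powersetCard.ofFinEmbEquiv.symm J) with hy
    have hxi : Function.Injective x := (Set.powersetCard.ofFinEmbEquiv.symm I).injective
    have hyi : Function.Injective y := (Set.powersetCard.ofFinEmbEquiv.symm J).injective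
    have e1 : (b.exteriorPower (i + 1)) I = exteriorPower.ιMulti ℝ (i + 1) (b ∘ x) := by
      rw [← OrthonormalBasis.coe_toBasis, OrthonormalBasis.toBasis_exteriorPower,
        exteriorPower.basis_apply, OrthonormalBasis.coe_toBasis]
      rfl
    have e2 : (c.exteriorPower (i + 1)) J = exteriorPower.ιMulti ℝ (i + 1) (c ∘ y) := by
      rw [← OrthonormalBasis.coe_toBasis, OrthonormalBasis.toBasis_exteriorPower,
        exteriorPower.basis_apply, OrthonormalBasis.coe_toBasis]
      rfl
    rw [e1, e2, exteriorPower.map_apply_ιMulti, exteriorPower.inner_ιMulti_ιMulti,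
      Matrix.det_succ_row_zero]
    refine (Finset.abs_sum_le_sum_abs _ _).trans ?_
    calc _ ≤ ∑ _j : Fin (i + 1), K := by
          refine Finset.sum_le_sum fun j _ => ?_
          have hminor : (Matrix.of fun (a : Fin (i + 1)) (a' : Fin (i + 1)) =>
              ⟪(c ∘ y) a', (A ∘ b ∘ x) a⟫).submatrix Fin.succ j.succAbove =
              Matrix.of fun (a : Fin i) (a' : Fin i) =>
                ⟪(c ∘ y ∘ j.succAbove) a', (A ∘ b ∘ x ∘ Fin.succ) a⟫ := rfl
          rw [hminor, ← exteriorPower.inner_ιMulti_ιMulti, abs_mul, abs_mul, abs_pow, abs_neg,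
            abs_one, one_pow, one_mul, mul_comm]
          refine mul_le_mul ?_ ?_ (abs_nonneg _) (by positivity)
          · refine (abs_real_inner_le_norm _ _).trans ?_
            rw [norm_ιMulti_of_orthonormal
              (c.orthonormal.comp _ (hyi.comp Fin.succAbove_right_injective)), one_mul,
              ← exteriorPower.map_apply_ιMulti]
            refine ((exteriorPower.map i A).toContinuousLinearMap.le_opNorm _).trans ?_
            rw [norm_ιMulti_of_orthonormal
              (b.orthonormal.comp _ (hxi.comp (Fin.succ_injective i))), mul_one]
          · refine (abs_real_inner_le_norm _ _).trans ?_
            refine (mul_le_mul_of_nonneg_left (A.toContinuousLinearMap.le_opNorm (b (x 0)))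
              (norm_nonneg _)).trans ?_
            simp
      _ = (i + 1) * K := by simp
  have := norm_le_of_abs_inner_le (b.exteriorPower (i + 1)) (c.exteriorPower (i + 1))
    (exteriorPower.map (i + 1) A) (by positivity) key
  rw [← hn] at this
  refine this.trans (le_of_eq ?_)
  ring

theorem norm_exteriorPower_map_zero_le (A : V →ₗ[ℝ] W) :
    ‖(exteriorPower.map 0 A).toContinuousLinearMap‖ ≤ 1 := by
  refine ContinuousLinearMap.opNorm_le_bound _ zero_le_one fun v => ?_
  obtain ⟨r, rfl⟩ : ∃ r : ℝ, v = r • exteriorPower.ιMulti ℝ 0 (Fin.elim0 : Fin 0 → V) := by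
    refine ⟨exteriorPower.zeroEquiv ℝ V v, (exteriorPower.zeroEquiv ℝ V).injective ?_⟩
    rw [map_smul, exteriorPower.zeroEquiv_ιMulti]
    simp
  have hA : (exteriorPower.map 0 A).toContinuousLinearMap
      (r • exteriorPower.ιMulti ℝ 0 (Fin.elim0 : Fin 0 → V)) =
      r • exteriorPower.ιMulti ℝ 0 (A ∘ Fin.elim0) := by
    simp [exteriorPower.map_apply_ιMulti]
  rw [hA, norm_smul, norm_smul, norm_ιMulti_of_orthonormal ⟨fun i => i.elim0, fun i => i.elim0⟩,
    norm_ιMulti_of_orthonormal ⟨fun i => i.elim0, fun i => i.elim0⟩]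
  simp

/-- Lets the factor ‖A‖ be treated as the case k = 1 of the exterior cocycle. -/
theorem norm_le_norm_exteriorPower_map_one (A : V →ₗ[ℝ] W) :
    ‖A.toContinuousLinearMap‖ ≤ ‖(exteriorPower.map 1 A).toContinuousLinearMap‖ := by
  refine ContinuousLinearMap.opNorm_le_bound _ (by positivity) fun v => ?_
  have h1 : ‖exteriorPower.ιMulti ℝ 1 (fun _ => v)‖ = ‖v‖ := by
    have h := exteriorPower.inner_ιMulti_self (fun _ : Fin 1 => v)
    rw [real_inner_self_eq_norm_sq, Matrix.det_fin_one, Matrix.gram_apply,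
      real_inner_self_eq_norm_sq] at h
    exact (pow_left_inj₀ (norm_nonneg _) (norm_nonneg _) two_ne_zero).1 h
  have h2 : ‖exteriorPower.ιMulti ℝ 1 (fun _ => A v)‖ = ‖A v‖ := by
    have h := exteriorPower.inner_ιMulti_self (fun _ : Fin 1 => A v)
    rw [real_inner_self_eq_norm_sq, Matrix.det_fin_one, Matrix.gram_apply,
      real_inner_self_eq_norm_sq] at h
    exact (pow_left_inj₀ (norm_nonneg _) (norm_nonneg _) two_ne_zero).1 h
  have h3 := (exteriorPower.map 1 A).toContinuousLinearMap.le_opNorm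
    (exteriorPower.ιMulti ℝ 1 fun _ => v)
  have h4 : (exteriorPower.map 1 A).toContinuousLinearMap (exteriorPower.ιMulti ℝ 1 fun _ => v) =
      exteriorPower.ιMulti ℝ 1 fun _ => A v := exteriorPower.map_apply_ιMulti A _
  rw [h4, h1, h2] at h3
  exact h3

theorem exists_elog_exteriorPower_map_succ_le (d i : ℕ) : ∃ c : NNReal,
    ∀ {V W : Type*} [NormedAddCommGroup V] [InnerProductSpace ℝ V] [FiniteDimensional ℝ V]
      [NormedAddCommGroup W] [InnerProductSpace ℝ W] [FiniteDimensional ℝ W]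
      (_ : Module.finrank ℝ V = d) (_ : Module.finrank ℝ W = d) (A : V →ₗ[ℝ] W),
      elog ‖(exteriorPower.map (i + 1) A).toContinuousLinearMap‖ ≤ ((c : ℝ) : EReal) +
        (elog ‖(exteriorPower.map i A).toContinuousLinearMap‖ +
          elog ‖A.toContinuousLinearMap‖) := by
  obtain ⟨C, hC, h⟩ := exists_norm_exteriorPower_map_succ_le d i
  refine ⟨(Real.log (max C 1)).toNNReal, ?_⟩
  intro V W _ _ _ _ _ _ hV hW A
  have hpos : 0 < max C 1 := lt_max_of_lt_right one_pos
  rw [Real.coe_toNNReal _ (Real.log_nonneg (le_max_right _ _)), ← elog_of_pos hpos,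
    ← elog_mul (r := ‖(exteriorPower.map i A).toContinuousLinearMap‖) (by positivity),
    ← elog_mul hpos.le]
  exact elog_mono ((h hV hW A).trans
    (mul_le_mul_of_nonneg_right (le_max_left _ _) (by positivity)))

/-- Transfers log⁺-integrability from F to its exterior powers. -/
theorem exists_toENNReal_elog_exteriorPower_map_le (d k : ℕ) : ∃ c : NNReal,
    ∀ {V W : Type*} [NormedAddCommGroup V] [InnerProductSpace ℝ V] [FiniteDimensional ℝ V]
      [NormedAddCommGroup W] [InnerProductSpace ℝ W] [FiniteDimensional ℝ W]
      (_ : Module.finrank ℝ V = d) (_ : Module.finrank ℝ W = d) (A : V →ₗ[ℝ] W),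
      (elog ‖(exteriorPower.map k A).toContinuousLinearMap‖).toENNReal ≤
        c + k * (elog ‖A.toContinuousLinearMap‖).toENNReal := by
  induction k with
  | zero =>
    refine ⟨0, ?_⟩
    intro V W _ _ _ _ _ _ hV hW A
    rw [EReal.toENNReal_of_nonpos]
    · exact zero_le
    · rw [← elog_one]
      exact elog_mono (norm_exteriorPower_map_zero_le A)
  | succ k ih =>
    obtain ⟨c, hc⟩ := ih
    obtain ⟨c', hc'⟩ := exists_elog_exteriorPower_map_succ_le d k
    refine ⟨c' + c, ?_⟩
    intro V W _ _ _ _ _ _ hV hW A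
    refine (EReal.toENNReal_le_toENNReal (hc' hV hW A)).trans ?_
    refine EReal.toENNReal_add_le.trans ?_
    refine (add_le_add le_rfl EReal.toENNReal_add_le).trans ?_
    have h1 : (((c' : ℝ) : EReal)).toENNReal = c' := by simp
    rw [h1]
    refine (add_le_add le_rfl (add_le_add (hc hV hW A) le_rfl)).trans (le_of_eq ?_)
    push_cast
    ring

end ExteriorNorm

/-! ### Logarithmic loss in a Gaussian random direction -/

section Gaussian

open ProbabilityTheory RealInnerProductSpace

/-- The Gaussian density is at most 1, and the positive part of -log |s| is supported in [-1, 1],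
where the logarithm is integrable. -/
theorem lintegral_neg_log_gaussianReal_ne_top :
    ∫⁻ s, ENNReal.ofReal (-Real.log s) ∂(gaussianReal 0 1) ≠ ∞ := by
  have hle : ∀ s, gaussianPDF 0 1 s ≤ 1 := fun s => by
    rw [gaussianPDF, ← ENNReal.ofReal_one]
    refine ENNReal.ofReal_le_ofReal ?_
    rw [gaussianPDFReal]
    refine mul_le_one₀ (inv_le_one_of_one_le₀ ?_) (Real.exp_nonneg _) (Real.exp_le_one_iff.2 ?_)
    · rw [Real.one_le_sqrt]
      have := Real.pi_gt_three
      simp only [NNReal.coe_one]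
      linarith
    · rw [neg_div]
      exact neg_nonpos.2 (by positivity)
  have hind : ∀ s : ℝ, ENNReal.ofReal (-Real.log s) =
      (Set.Ioc (-1 : ℝ) 1).indicator (fun s => ENNReal.ofReal (-Real.log s)) s := fun s => by
    by_cases hs : s ∈ Set.Ioc (-1 : ℝ) 1
    · rw [Set.indicator_of_mem hs]
    · rw [Set.indicator_of_notMem hs]
      refine ENNReal.ofReal_of_nonpos (neg_nonpos.2 ?_)
      rw [← Real.log_abs]
      refine Real.log_nonneg ?_
      rw [Set.mem_Ioc, not_and_or, not_lt, not_le] at hs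
      rcases hs with hs | hs
      · exact le_abs.2 (Or.inr (by linarith))
      · exact le_abs.2 (Or.inl hs.le)
  have hint : IntervalIntegrable (fun s => -Real.log s) volume (-1) 1 :=
    intervalIntegral.intervalIntegrable_log'.neg
  rw [gaussianReal_of_var_ne_zero _ one_ne_zero]
  refine ne_top_of_le_ne_top (b := ∫⁻ s in Set.Ioc (-1 : ℝ) 1, ENNReal.ofReal (-Real.log s)) ?_ ?_
  · exact ((hasFiniteIntegral_iff_norm _).1 hint.1.2 |>.trans_le' (lintegral_mono fun s =>
      ENNReal.ofReal_le_ofReal (le_abs_self _))).ne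
  · rw [lintegral_withDensity_eq_lintegral_mul _ (measurable_gaussianPDF 0 1) (by fun_prop),
      ← lintegral_indicator measurableSet_Ioc]
    refine lintegral_mono fun s => ?_
    simp only [Pi.mul_apply]
    rw [← hind s]
    exact (mul_le_mul_left (hle s) _).trans (one_mul _).le

variable {D : ℕ}

theorem map_inner_stdGaussian (u : EuclideanSpace ℝ (Fin D)) (hu : ‖u‖ = 1) :
    (stdGaussian (EuclideanSpace ℝ (Fin D))).map (innerSL ℝ u) = gaussianReal 0 1 := by
  rw [IsGaussian.map_eq_gaussianReal, integral_strongDual_stdGaussian,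
    variance_dual_stdGaussian, innerSL_apply_norm, hu]
  simp

/-- The mean logarithmic defect of a random direction with respect to a fixed linear form. -/
def gaussianDefect (D : ℕ) : ℝ≥0∞ :=
  ENNReal.ofReal (Real.log 2) +
    (∫⁻ v, ENNReal.ofReal ‖v‖ ∂(stdGaussian (EuclideanSpace ℝ (Fin D))) +
      ∫⁻ s, ENNReal.ofReal (-Real.log s) ∂(gaussianReal 0 1))

theorem gaussianDefect_ne_top (D : ℕ) : gaussianDefect D ≠ ∞ := by
  refine ENNReal.add_ne_top.2 ⟨ENNReal.ofReal_ne_top, ENNReal.add_ne_top.2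
    ⟨?_, lintegral_neg_log_gaussianReal_ne_top⟩⟩
  have h : Integrable (id : EuclideanSpace ℝ (Fin D) → _)
      (stdGaussian (EuclideanSpace ℝ (Fin D))) :=
    IsGaussian.integrable_id
  exact ((hasFiniteIntegral_iff_norm _).1 h.2).ne

/-- Choose w₀ in the unit ball with ‖A w₀‖ > ‖A‖/2 and let w represent v ↦ ⟨A w₀, A v⟩/‖A w₀‖. Then
|⟨w, v⟩| ≤ ‖A v‖ and ‖w‖ ≥ ‖A‖/2, while ⟨w/‖w‖, v⟩ is standard normal. The terms of `gaussianDefect`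
come from the factor 1/2, from log ‖v‖ ≤ ‖v‖, and from the normal marginal. -/
theorem lintegral_defect_le {W : Type*} [NormedAddCommGroup W] [InnerProductSpace ℝ W]
    (A : EuclideanSpace ℝ (Fin D) →ₗ[ℝ] W) :
    ∫⁻ v, (elog ‖A.toContinuousLinearMap‖ - elog (‖A v‖ / ‖v‖)).toENNReal
      ∂(stdGaussian (EuclideanSpace ℝ (Fin D))) ≤ gaussianDefect D := by
  set γ := stdGaussian (EuclideanSpace ℝ (Fin D)) with hγ
  set a := ‖A.toContinuousLinearMap‖ with ha
  rcases (norm_nonneg A.toContinuousLinearMap).eq_or_lt with h0 | hpos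
  · simp [ha, ← h0, elog_zero]
  rw [← ha] at hpos
  obtain ⟨w₀, hw₀, hw₀'⟩ := A.toContinuousLinearMap.exists_lt_apply_of_lt_opNorm
    (show a / 2 < ‖A.toContinuousLinearMap‖ by rw [← ha]; linarith)
  have hAw : 0 < ‖A w₀‖ := (by positivity : (0 : ℝ) < a / 2).trans hw₀'
  set w : EuclideanSpace ℝ (Fin D) := (InnerProductSpace.toDual ℝ _).symm
    ((innerSL ℝ ((‖A w₀‖⁻¹ : ℝ) • A w₀)).comp A.toContinuousLinearMap) with hw
  have hwin : ∀ v, ⟪w, v⟫ = ‖A w₀‖⁻¹ * ⟪A w₀, A v⟫ := fun v => by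
    rw [hw, InnerProductSpace.toDual_symm_apply]
    simp
  have hwA : ∀ v, |⟪w, v⟫| ≤ ‖A v‖ := fun v => by
    rw [hwin, abs_mul, abs_inv, abs_norm, inv_mul_le_iff₀ hAw]
    exact abs_real_inner_le_norm _ _
  have hwn : a / 2 ≤ ‖w‖ := by
    have h1 : ‖A w₀‖ = ⟪w, w₀⟫ := by
      rw [hwin, real_inner_self_eq_norm_sq]
      field_simp
    have h2 : ⟪w, w₀⟫ ≤ ‖w‖ * ‖w₀‖ := real_inner_le_norm _ _
    have h3 : ‖w‖ * ‖w₀‖ ≤ ‖w‖ := mul_le_of_le_one_right (norm_nonneg _) hw₀.le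
    exact hw₀'.le.trans (h1.le.trans (h2.trans h3))
  have hwpos : 0 < ‖w‖ := by linarith
  set u : EuclideanSpace ℝ (Fin D) := (‖w‖⁻¹ : ℝ) • w with hu
  have hun : ‖u‖ = 1 := by
    rw [hu, norm_smul, norm_inv, norm_norm, inv_mul_cancel₀ hwpos.ne']
  have hmap := map_inner_stdGaussian u hun
  have hmeas : Measurable (innerSL ℝ u : EuclideanSpace ℝ (Fin D) → ℝ) :=
    (innerSL ℝ u).continuous.measurable
  have hne : ∀ᵐ v ∂γ, ⟪u, v⟫ ≠ 0 := by
    have h1 : ∀ᵐ s ∂(gaussianReal 0 1), s ≠ 0 := by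
      have := nullSingletonClass_gaussianReal (μ := 0) (v := 1) one_ne_zero
      exact compl_mem_ae_iff.2 (measure_singleton 0)
    rw [← hmap] at h1
    exact ae_of_ae_map hmeas.aemeasurable h1
  have hbound : ∀ᵐ v ∂γ, (elog a - elog (‖A v‖ / ‖v‖)).toENNReal ≤
      ENNReal.ofReal (Real.log 2) + (ENNReal.ofReal ‖v‖ + ENNReal.ofReal (-Real.log ⟪u, v⟫)) := by
    filter_upwards [hne] with v hv
    have hv0 : 0 < ‖v‖ := norm_pos_iff.2 fun h => hv (by simp [h])
    have huv : 0 < |⟪u, v⟫| := abs_pos.2 hv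
    have hAv : ‖w‖ * |⟪u, v⟫| ≤ ‖A v‖ := by
      refine le_trans (le_of_eq ?_) (hwA v)
      rw [hu, real_inner_smul_left, abs_mul, abs_inv, abs_norm]
      field_simp
    have hAv0 : 0 < ‖A v‖ := (mul_pos hwpos huv).trans_le hAv
    rw [elog_of_pos hpos, elog_of_pos (div_pos hAv0 hv0), ← EReal.coe_sub,
      EReal.real_coe_toENNReal, Real.log_div hAv0.ne' hv0.ne']
    refine le_trans (ENNReal.ofReal_le_ofReal ?_)
      (ENNReal.ofReal_add_le.trans (add_le_add le_rfl ENNReal.ofReal_add_le))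
    have h1 : Real.log ‖w‖ + Real.log ⟪u, v⟫ ≤ Real.log ‖A v‖ := by
      rw [← Real.log_abs ⟪u, v⟫, ← Real.log_mul hwpos.ne' huv.ne']
      exact Real.log_le_log (mul_pos hwpos huv) hAv
    have h2 : Real.log a - Real.log 2 ≤ Real.log ‖w‖ := by
      rw [← Real.log_div hpos.ne' two_ne_zero]
      exact Real.log_le_log (by positivity) hwn
    have h3 : Real.log ‖v‖ ≤ ‖v‖ := Real.log_le_self (norm_nonneg _)
    linarith
  refine (lintegral_mono_ae hbound).trans (le_of_eq ?_)
  have hlog : Measurable fun s : ℝ => ENNReal.ofReal (-Real.log s) := by fun_prop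
  rw [lintegral_add_left measurable_const, lintegral_add_left (by fun_prop), lintegral_const,
    measure_univ, mul_one, gaussianDefect, ← hmap, lintegral_map hlog hmeas]
  rfl

end Gaussian

/-! ### A good deterministic direction for a random operator -/

section RandomOperator

theorem coe_sub_coe_add (a b c : ℝ≥0∞) :
    (a : EReal) - ((b + c : ℝ≥0∞) : EReal) = (a : EReal) - b - c := by
  rw [EReal.coe_ennreal_add, sub_eq_add_neg, sub_eq_add_neg, sub_eq_add_neg,
    EReal.neg_add (by simp) (by simp), add_assoc, sub_eq_add_neg]

theorem sub_toENNReal_sub_le {x y : EReal} (hx : x ≠ ⊤) :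
    x - ((x - y).toENNReal : EReal) ≤ y := by
  induction x with
  | bot => simp
  | top => exact absurd rfl hx
  | coe x =>
    induction y with
    | bot => simp
    | top => simp
    | coe y =>
      refine EReal.sub_le_of_le_add ?_
      rw [EReal.coe_toENNReal_eq_max]
      calc (x : EReal) = y + ((x : EReal) - y) := by norm_cast; ring_nf
        _ ≤ _ := by gcongr; exact le_max_right _ _

open ProbabilityTheory

variable {Ω : Type*} [MeasurableSpace Ω] {P : Measure Ω} [IsProbabilityMeasure P]

/-- The supremum over the directions of the expected logarithmic growth of a random linear map is
at least the expected logarithm of the norm, up to a constant that only depends on the dimension. -/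
theorem eintegral_elog_norm_sub_le_iSup {D : ℕ} (hD : 0 < D) {V : Type*} [NormedAddCommGroup V]
    [InnerProductSpace ℝ V] [FiniteDimensional ℝ V] (hV : Module.finrank ℝ V = D)
    {W : Ω → Type*} [∀ ω, NormedAddCommGroup (W ω)] [∀ ω, InnerProductSpace ℝ (W ω)]
    (A : ∀ ω, V →ₗ[ℝ] W ω) (hA : ∀ v, Measurable fun ω => ‖A ω v‖)
    (hn : QuasiIntegrable P fun ω => elog ‖(A ω).toContinuousLinearMap‖)
    (hnm : Measurable fun ω => elog ‖(A ω).toContinuousLinearMap‖) :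
    eintegral P (fun ω => elog ‖(A ω).toContinuousLinearMap‖) -
        (((gaussianDefect D).toNNReal : ℝ) : EReal) ≤
      ⨆ v : {v : V // v ≠ 0}, eintegral P fun ω => elog (‖A ω v‖ / ‖(v : V)‖) := by
  set γ := stdGaussian (EuclideanSpace ℝ (Fin D)) with hγ
  set e : EuclideanSpace ℝ (Fin D) ≃ₗᵢ[ℝ] V :=
    ((stdOrthonormalBasis ℝ V).reindex (finCongr hV)).repr.symm with he
  set δ : EuclideanSpace ℝ (Fin D) × Ω → ℝ≥0∞ := fun z =>
    (elog ‖(A z.2).toContinuousLinearMap‖ - elog (‖A z.2 (e z.1)‖ / ‖z.1‖)).toENNReal with hδ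
  have hAe : Measurable fun z : EuclideanSpace ℝ (Fin D) × Ω => ‖A z.2 (e z.1)‖ :=
    measurable_uncurry_of_continuous_of_measurable (u := fun c ω => ‖A ω (e c)‖)
      (fun ω => ((A ω).toContinuousLinearMap.continuous.comp e.continuous).norm)
      (fun c => hA (e c))
  have hδm : Measurable δ := by
    refine Measurable.ereal_toENNReal ?_
    simp only [sub_eq_add_neg]
    refine (hnm.comp measurable_snd).add (Measurable.neg ?_)
    exact continuous_elog.measurable.comp (hAe.div measurable_fst.norm)
  have hδle : ∀ ω, ∫⁻ c, δ (c, ω) ∂γ ≤ gaussianDefect D := fun ω => by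
    have h := lintegral_defect_le ((A ω) ∘ₗ e.toLinearEquiv.toLinearMap)
    have hnorm : ‖((A ω) ∘ₗ e.toLinearEquiv.toLinearMap).toContinuousLinearMap‖ =
        ‖(A ω).toContinuousLinearMap‖ :=
      (A ω).toContinuousLinearMap.opNorm_comp_linearIsometryEquiv e
    rw [hnorm] at h
    exact h
  -- This needs D > 0: a coordinate of c is standard normal, hence almost surely nonzero.
  have hne : ∀ᵐ c ∂γ, c ≠ 0 := by
    have : NeZero D := ⟨hD.ne'⟩
    set u : EuclideanSpace ℝ (Fin D) := EuclideanSpace.single 0 1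
    have hmap := map_inner_stdGaussian u (by simp [u])
    have h1 : ∀ᵐ s ∂(gaussianReal 0 1), s ≠ 0 := by
      have := nullSingletonClass_gaussianReal (μ := 0) (v := 1) one_ne_zero
      exact compl_mem_ae_iff.2 (measure_singleton 0)
    rw [← hmap] at h1
    filter_upwards [ae_of_ae_map (innerSL ℝ u).continuous.measurable.aemeasurable h1] with c hc h
    simp [h] at hc
  have hFm : Measurable fun c => ∫⁻ ω, δ (c, ω) ∂P := hδm.lintegral_prod_right'
  have hswap : ∫⁻ c, ∫⁻ ω, δ (c, ω) ∂P ∂γ ≤ gaussianDefect D := by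
    rw [lintegral_lintegral_swap (f := fun c ω => δ (c, ω)) hδm.aemeasurable]
    refine (lintegral_mono hδle).trans ?_
    simp
  -- After exchanging the integrals, the expected defect averages over c to at most the constant, so
  -- some nonzero c does no worse than the average.
  obtain ⟨c, hc0, hc⟩ : ∃ c, c ≠ 0 ∧ ∫⁻ ω, δ (c, ω) ∂P ≤ gaussianDefect D := by
    obtain ⟨c, hc, hc'⟩ := exists_notMem_null_le_lintegral hFm.aemeasurable
      (N := {c | ¬ c ≠ 0}) hne
    exact ⟨c, not_not.1 hc, hc'.trans hswap⟩
  have hc0' : e c ≠ 0 := fun h => hc0 (e.map_eq_zero_iff.1 h)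
  refine le_trans ?_ (le_iSup (fun v : {v : V // v ≠ 0} =>
    eintegral P fun ω => elog (‖A ω v‖ / ‖(v : V)‖)) ⟨e c, hc0'⟩)
  set K := (gaussianDefect D).toNNReal with hK
  have hKc : (K : ℝ≥0∞) = gaussianDefect D := ENNReal.coe_toNNReal (gaussianDefect_ne_top D)
  set a : Ω → ℝ≥0∞ := fun ω => (elog ‖(A ω).toContinuousLinearMap‖).toENNReal with ha
  set b : Ω → ℝ≥0∞ := fun ω => (-elog ‖(A ω).toContinuousLinearMap‖).toENNReal with hb
  have ham : Measurable a := hnm.ereal_toENNReal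
  have hbm : Measurable b := hnm.neg.ereal_toENNReal
  have hdm : Measurable fun ω => δ (c, ω) := hδm.comp measurable_prodMk_left
  calc eintegral P (fun ω => elog ‖(A ω).toContinuousLinearMap‖) - ((K : ℝ) : EReal)
      ≤ (∫⁻ ω, a ω ∂P : ℝ≥0∞) - (∫⁻ ω, (b ω + δ (c, ω)) ∂P : ℝ≥0∞) := by
        have hKe : ((K : ℝ) : EReal) = ((K : ℝ≥0∞) : EReal) := rfl
        have : eintegral P (fun ω => elog ‖(A ω).toContinuousLinearMap‖) - ((K : ℝ) : EReal) =
            (∫⁻ ω, a ω ∂P : ℝ≥0∞) - ((∫⁻ ω, b ω ∂P + K : ℝ≥0∞) : EReal) := by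
          rw [coe_sub_coe_add]
          rfl
        rw [this, lintegral_add_left hbm]
        refine EReal.sub_le_sub le_rfl (EReal.coe_ennreal_le_coe_ennreal_iff.2 ?_)
        rw [hKc]
        gcongr
    _ = eintegral P (fun ω => (a ω : EReal) - (b ω + δ (c, ω) : ℝ≥0∞)) :=
        (eintegral_coe_sub ham.aemeasurable (hbm.add hdm).aemeasurable hn.2.ne).symm
    _ ≤ eintegral P fun ω => elog (‖A ω (e c)‖ / ‖e c‖) := by
        refine eintegral_mono_ae (ae_of_all _ fun ω => ?_)
        rw [coe_sub_coe_add, toENNReal_sub_toENNReal_neg, e.norm_map]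
        exact sub_toENNReal_sub_le (elog_ne_top _)

end RandomOperator

/-! ### Measurable global frames -/

section Frame

variable {d : ℕ} {X : Type*} [MeasurableSpace X] {E : X → Type*}
  [∀ x, NormedAddCommGroup (E x)] [∀ x, InnerProductSpace ℝ (E x)] [MeasurableSpace (Total d E)]

/-- At x, use the trivialization of least index whose domain contains x. Only measurability of the
sections with constant coordinates is needed later. -/
theorem IsMeasurableEuclideanBundle.exists_global_trivialization
    (hE : IsMeasurableEuclideanBundle d E) :
    ∃ L : ∀ x, E x ≃ₗ[ℝ] EuclideanSpace ℝ (Fin d), ∀ v,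
      Measurable (fun x => (⟨x, (L x).symm v⟩ : Total d E)) := by
  classical
  obtain ⟨U, L, hU, hcov, -, hL⟩ := hE.exists_trivializations
  have hex : ∀ x, ∃ i, x ∈ U i := fun x => by
    have : x ∈ ⋃ i, U i := hcov ▸ Set.mem_univ x
    exact Set.mem_iUnion.1 this
  set ind : X → ℕ := fun x => Nat.find (hex x) with hind
  have hindm : Measurable ind := measurable_find hex fun i => hU i
  refine ⟨fun x => L (ind x) x, fun v s hs => ?_⟩
  have hset : (fun x => (⟨x, (L (ind x) x).symm v⟩ : Total d E)) ⁻¹' s =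
      ⋃ i, (ind ⁻¹' {i} ∩ Subtype.val ''
        ((fun y : U i => (⟨y.1, (L i y.1).symm v⟩ : Total d E)) ⁻¹' s)) := by
    ext x
    simp only [Set.mem_preimage, Set.mem_iUnion, Set.mem_inter_iff, Set.mem_singleton_iff,
      Set.mem_image, Subtype.exists, exists_and_right, exists_eq_right]
    constructor
    · intro hx
      exact ⟨ind x, rfl, Nat.find_spec (hex x), hx⟩
    · rintro ⟨i, hi, _, hx⟩
      rw [hi]
      exact hx
  rw [hset]
  refine MeasurableSet.iUnion fun i => (hindm (measurableSet_singleton i)).inter ?_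
  exact (hU i).subtype_image (((hL i).comp (measurable_id.prodMk measurable_const)) hs)

/-- The frame of `⋀^k E_x` induced by linear coordinates on `E_x`. -/
def exteriorFrame (L : ∀ x, E x ≃ₗ[ℝ] EuclideanSpace ℝ (Fin d)) (k : ℕ) (x : X) :
    EuclideanSpace ℝ (Set.powersetCard (Fin d) k) ≃ₗ[ℝ] ⋀[ℝ]^k (E x) :=
  (WithLp.linearEquiv 2 ℝ (Set.powersetCard (Fin d) k → ℝ)).trans
    (((EuclideanSpace.basisFun (Fin d) ℝ).toBasis.map (L x).symm).exteriorPower k).equivFun.symm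

theorem exteriorFrame_apply (L : ∀ x, E x ≃ₗ[ℝ] EuclideanSpace ℝ (Fin d)) (k : ℕ) (x : X)
    (c : EuclideanSpace ℝ (Set.powersetCard (Fin d) k)) :
    exteriorFrame L k x c = ∑ I, c I • exteriorPower.ιMulti ℝ k fun a =>
      (L x).symm (EuclideanSpace.single (Set.powersetCard.ofFinEmbEquiv.symm I a) 1) := by
  simp only [exteriorFrame, LinearEquiv.trans_apply, Module.Basis.equivFun_symm_apply,
    exteriorPower.basis_apply]
  refine Finset.sum_congr rfl fun I _ => ?_
  rw [exteriorPower.ιMulti_family]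
  congr 2
  funext a
  simp

end Frame

/-! ### Measurability of the cocycle -/

namespace RandomBundleMorphism

variable {T : Type*} [MeasurableSpace T] {d : ℕ} {X : Type*} [MeasurableSpace X] {E : X → Type*}
  [∀ x, NormedAddCommGroup (E x)] [∀ x, InnerProductSpace ℝ (E x)] [MeasurableSpace (Total d E)]
  (R : RandomBundleMorphism T d E)

section Measurability

open RealInnerProductSpace

theorem measurable_iter {s : ∀ x, E x} (hs : Measurable fun x => (⟨x, s x⟩ : Total d E)) (n : ℕ) :
    Measurable fun z : (ℕ → T) × X =>
      (⟨R.orbit z.1 z.2 n, R.iter z.1 z.2 n (s z.2)⟩ : Total d E) := by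
  induction n with
  | zero => exact hs.comp measurable_snd
  | succ n ih =>
    exact R.measurable_F.comp
      (((measurable_pi_apply n).comp measurable_fst).prodMk ih)

theorem measurable_inner_iter (hE : IsMeasurableEuclideanBundle d E)
    {L : ∀ x, E x ≃ₗ[ℝ] EuclideanSpace ℝ (Fin d)}
    (hL : ∀ v, Measurable (fun x => (⟨x, (L x).symm v⟩ : Total d E))) (n : ℕ)
    (v w : EuclideanSpace ℝ (Fin d)) :
    Measurable fun z : (ℕ → T) × X =>
      ⟪R.iter z.1 z.2 n ((L z.2).symm v), R.iter z.1 z.2 n ((L z.2).symm w)⟫ := by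
  have hn : ∀ v, Measurable fun z : (ℕ → T) × X => ‖R.iter z.1 z.2 n ((L z.2).symm v)‖ := fun v =>
    hE.measurable_norm.comp (R.measurable_iter (hL v) n)
  -- Only the norm is assumed measurable; inner products follow by polarization.
  simp only [real_inner_eq_norm_mul_self_add_norm_mul_self_sub_norm_sub_mul_self_div_two,
    ← map_sub]
  exact ((((hn _).mul (hn _)).add ((hn _).mul (hn _))).sub ((hn _).mul (hn _))).div_const _

variable [∀ x, FiniteDimensional ℝ (E x)]

/-- The squared norm expands into Gram determinants, which are polynomials in the inner products of
the iterated frame vectors. -/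
theorem measurable_norm_map_iter (hE : IsMeasurableEuclideanBundle d E)
    {L : ∀ x, E x ≃ₗ[ℝ] EuclideanSpace ℝ (Fin d)}
    (hL : ∀ v, Measurable (fun x => (⟨x, (L x).symm v⟩ : Total d E))) (k n : ℕ)
    (c : EuclideanSpace ℝ (Set.powersetCard (Fin d) k)) :
    Measurable fun z : (ℕ → T) × X =>
      ‖exteriorPower.map k (R.iter z.1 z.2 n) (exteriorFrame L k z.2 c)‖ := by
  simp only [@norm_eq_sqrt_real_inner, exteriorFrame_apply, map_sum, map_smul,
    exteriorPower.map_apply_ιMulti, sum_inner, inner_sum, real_inner_smul_left,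
    real_inner_smul_right, exteriorPower.inner_ιMulti_ιMulti, Matrix.det_apply, Matrix.of_apply,
    Function.comp_apply]
  refine Measurable.sqrt (Finset.measurable_fun_sum _ fun I _ => Finset.measurable_fun_sum _
    fun J _ => Measurable.const_mul (Measurable.const_mul (Finset.measurable_fun_sum _ fun σ _ =>
      Measurable.const_smul (Finset.measurable_fun_prod _ fun a _ => ?_) _) _) _)
  exact R.measurable_inner_iter hE hL n _ _

theorem measurable_logGrowth (hE : IsMeasurableEuclideanBundle d E)
    {L : ∀ x, E x ≃ₗ[ℝ] EuclideanSpace ℝ (Fin d)}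
    (hL : ∀ v, Measurable (fun x => (⟨x, (L x).symm v⟩ : Total d E))) (k n : ℕ)
    (c : EuclideanSpace ℝ (Set.powersetCard (Fin d) k)) :
    Measurable fun z : (ℕ → T) × X => R.logGrowth k n z.1 z.2 (exteriorFrame L k z.2 c) := by
  have h0 : Measurable fun z : (ℕ → T) × X => ‖exteriorFrame L k z.2 c‖ := by
    -- The denominator is the case n = 0 of the numerator.
    have e : (fun z : (ℕ → T) × X => ‖exteriorPower.map k (R.iter z.1 z.2 0)
        (exteriorFrame L k z.2 c)‖) = fun z => ‖exteriorFrame L k z.2 c‖ := by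
      funext z
      change ‖exteriorPower.map k (LinearMap.id : E z.2 →ₗ[ℝ] E z.2) (exteriorFrame L k z.2 c)‖ = _
      rw [exteriorPower.map_id, LinearMap.id_apply]
    exact e ▸ R.measurable_norm_map_iter hE hL k 0 c
  exact continuous_elog.measurable.comp ((R.measurable_norm_map_iter hE hL k n c).div h0)

end Measurability

end RandomBundleMorphism

/-! ### Bernoulli measure, skew product and cocycle -/

section Shift

variable {T : Type*} [MeasurableSpace T] (p : Measure T) [IsProbabilityMeasure p]

instance : IsProbabilityMeasure (bernoulli p) := by
  unfold bernoulli
  infer_instance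

/-- Prepend a letter to a sequence. -/
def consSeq (z : T × (ℕ → T)) : ℕ → T
  | 0 => z.1
  | n + 1 => z.2 n

theorem measurable_consSeq : Measurable (consSeq (T := T)) := by
  refine measurable_pi_iff.2 fun n => ?_
  cases n with
  | zero => exact measurable_fst
  | succ n => exact (measurable_pi_apply n).comp measurable_snd

/-- Checked on cylinders. Filling the constrained indices up to an initial segment with full factors
makes the preimage a product of the condition on letter 0 and a cylinder in the tail. -/
theorem measurePreserving_consSeq :
    MeasurePreserving consSeq (p.prod (bernoulli p)) (bernoulli p) := by
  refine ⟨measurable_consSeq, Measure.eq_infinitePi _ fun s t ht => ?_⟩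
  classical
  set t' : ℕ → Set T := fun i => if i ∈ s then t i else Set.univ with ht'
  have htm : ∀ i, MeasurableSet (t' i) := fun i => by
    by_cases hi : i ∈ s <;> simp [ht', hi, ht]
  obtain ⟨N, hN⟩ : ∃ N, s ⊆ Finset.range (N + 1) :=
    ⟨s.sup id, fun i hi => Finset.mem_range_succ_iff.2 (Finset.le_sup (f := id) hi)⟩
  have hpre : consSeq ⁻¹' ((s : Set ℕ).pi t) =
      t' 0 ×ˢ ((Finset.range N : Set ℕ).pi fun i => t' (i + 1)) := by
    ext z
    simp only [Set.mem_preimage, Set.mem_pi, Finset.mem_coe, Set.mem_prod, Finset.mem_range]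
    constructor
    · intro h
      refine ⟨?_, fun i _ => ?_⟩
      · by_cases h0 : 0 ∈ s
        · simpa [ht', h0, consSeq] using h 0 h0
        · simp [ht', h0]
      · by_cases h0 : i + 1 ∈ s
        · simpa [ht', h0, consSeq] using h (i + 1) h0
        · simp [ht', h0]
    · rintro ⟨h0, h1⟩ i hi
      cases i with
      | zero => simpa [ht', hi, consSeq] using h0
      | succ i => simpa [ht', hi, consSeq] using h1 i (by simpa using hN hi)
  have hprod : ∏ i ∈ s, p (t i) = ∏ i ∈ Finset.range (N + 1), p (t' i) := by
    rw [← Finset.prod_subset hN fun i _ hi => by simp [ht', hi]]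
    exact Finset.prod_congr rfl fun i hi => by simp [ht', hi]
  rw [Measure.map_apply measurable_consSeq
      (MeasurableSet.pi s.countable_toSet fun i _ => ht i),
    hpre, Measure.prod_prod, bernoulli, Measure.infinitePi_pi _ (fun i _ => htm _), hprod,
    Finset.prod_range_succ', mul_comm]

end Shift

namespace RandomBundleMorphism

variable {T : Type*} [MeasurableSpace T] {d : ℕ} {X : Type*} [MeasurableSpace X] {E : X → Type*}
  [∀ x, NormedAddCommGroup (E x)] [∀ x, InnerProductSpace ℝ (E x)] [MeasurableSpace (Total d E)]
  (R : RandomBundleMorphism T d E)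

/-- The skew product `(ω, x) ↦ (σ ω, f_{ω₀} x)`. -/
def skew (z : (ℕ → T) × X) : (ℕ → T) × X := (fun i => z.1 (i + 1), R.f (z.1 0) z.2)

theorem measurable_skew : Measurable R.skew :=
  (measurable_pi_iff.2 fun i => (measurable_pi_apply (i + 1)).comp measurable_fst).prodMk
    (R.measurable_f.comp (f := fun z : (ℕ → T) × X => (z.1 0, z.2))
      (((measurable_pi_apply 0).comp measurable_fst).prodMk measurable_snd))

theorem skew_iterate (n : ℕ) (z : (ℕ → T) × X) :
    R.skew^[n] z = (fun i => z.1 (n + i), R.orbit z.1 z.2 n) := by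
  induction n with
  | zero => simp [orbit]
  | succ n ih =>
    rw [Function.iterate_succ_apply', ih]
    simp only [skew, orbit, add_zero, Prod.mk.injEq, and_true]
    funext i
    exact congrArg z.1 (by omega)

/-- The cocycle identity, as an equality of maps with varying codomain. -/
theorem iter_add (ω : ℕ → T) (x : X) (n m : ℕ) :
    (⟨R.orbit ω x (n + m), R.iter ω x (n + m)⟩ : Σ y, E x →ₗ[ℝ] E y) =
      ⟨R.orbit (fun i => ω (n + i)) (R.orbit ω x n) m,
        R.iter (fun i => ω (n + i)) (R.orbit ω x n) m ∘ₗ R.iter ω x n⟩ := by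
  induction m with
  | zero => rfl
  | succ m ih =>
    exact congrArg (fun q : Σ y, E x →ₗ[ℝ] E y =>
      (⟨R.f (ω (n + m)) q.1, R.F (ω (n + m)) q.1 ∘ₗ q.2⟩ : Σ y, E x →ₗ[ℝ] E y)) ih

theorem measurePreserving_f {p : Measure T} [IsProbabilityMeasure p] {μ : Measure X}
    [IsProbabilityMeasure μ] (hμ : R.IsStationary p μ) :
    MeasurePreserving (fun z : T × X => R.f z.1 z.2) (p.prod μ) μ := by
  refine ⟨R.measurable_f, Measure.ext fun A hA => ?_⟩
  rw [Measure.map_apply R.measurable_f hA]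
  have hs := R.measurable_f hA
  have h := hμ (A.indicator 1) (measurable_one.indicator hA)
    ⟨1, fun x => by by_cases hx : x ∈ A <;> simp [hx]⟩
  have h1 : ∀ x, R.annealedKoopman p (A.indicator 1) x = (p {t | R.f t x ∈ A}).toReal := fun x => by
    have hm : MeasurableSet {t | R.f t x ∈ A} := measurable_prodMk_right hs
    have e : (fun t => A.indicator (1 : X → ℝ) (R.f t x)) =
        {t | R.f t x ∈ A}.indicator 1 := rfl
    rw [annealedKoopman, e, integral_indicator_one hm]
    rfl
  have hm : Measurable fun x => p {t | R.f t x ∈ A} := measurable_measure_prodMk_right hs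
  simp only [h1, integral_indicator_one hA] at h
  rw [integral_toReal hm.aemeasurable (ae_of_all _ fun x => measure_lt_top p _)] at h
  rw [Measure.prod_apply_symm hs]
  refine (ENNReal.toReal_eq_toReal_iff' ?_ (measure_ne_top μ A)).1 h
  refine ne_top_of_le_ne_top (b := 1) (by simp) ?_
  refine (lintegral_mono fun x => (prob_le_one : p {t | R.f t x ∈ A} ≤ 1)).trans ?_
  simp

/-- Split off the first letter by `consSeq`: the skew product sends (tω, x) to (ω, f_t x). The tail
ω is independent of (t, x), and f_t x has law μ by stationarity. -/
theorem measurePreserving_skew {p : Measure T} [IsProbabilityMeasure p] {μ : Measure X}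
    [IsProbabilityMeasure μ] (hμ : R.IsStationary p μ) :
    MeasurePreserving R.skew ((bernoulli p).prod μ) ((bernoulli p).prod μ) := by
  have h1 : MeasurePreserving (Prod.map consSeq id) ((p.prod (bernoulli p)).prod μ)
      ((bernoulli p).prod μ) := (measurePreserving_consSeq p).prod (MeasurePreserving.id μ)
  have h2 : MeasurePreserving (Prod.map Prod.swap id) ((p.prod (bernoulli p)).prod μ)
      (((bernoulli p).prod p).prod μ) :=
    Measure.measurePreserving_swap.prod (MeasurePreserving.id μ)
  have h3 : MeasurePreserving MeasurableEquiv.prodAssoc (((bernoulli p).prod p).prod μ)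
      ((bernoulli p).prod (p.prod μ)) := measurePreserving_prodAssoc _ _ _
  have h4 : MeasurePreserving (Prod.map id (fun z : T × X => R.f z.1 z.2))
      ((bernoulli p).prod (p.prod μ)) ((bernoulli p).prod μ) :=
    (MeasurePreserving.id _).prod (R.measurePreserving_f hμ)
  have h5 := h4.comp (h3.comp h2)
  refine ⟨R.measurable_skew, ?_⟩
  conv_lhs => rw [← h1.map_eq]
  rw [Measure.map_map R.measurable_skew h1.measurable]
  exact h5.map_eq

variable [∀ x, FiniteDimensional ℝ (E x)]

theorem logNorm_add_le (k n m : ℕ) (z : (ℕ → T) × X) :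
    R.logNorm k (n + m) z.1 z.2 ≤
      R.logNorm k n z.1 z.2 + R.logNorm k m (R.skew^[n] z).1 (R.skew^[n] z).2 := by
  -- The codomains agree only propositionally; applying a function of the pair (endpoint, map)
  -- avoids transport.
  have h := congrArg (fun q : Σ y, E z.2 →ₗ[ℝ] E y =>
    elog ‖(exteriorPower.map k q.2).toContinuousLinearMap‖) (R.iter_add z.1 z.2 n m)
  rw [skew_iterate]
  exact h.trans_le (elog_norm_exteriorPower_map_comp_le k _ _)

theorem iSup_logGrowth (k n : ℕ) (ω : ℕ → T) (x : X) :
    ⨆ v : {v : ⋀[ℝ]^k (E x) // v ≠ 0}, R.logGrowth k n ω x v = R.logNorm k n ω x :=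
  iSup_elog_div_eq_elog_norm _

theorem lintegral_logNorm_one_ne_top {p : Measure T} [IsProbabilityMeasure p] {μ : Measure X}
    [IsProbabilityMeasure μ] (hint : R.LogIntegrable p μ)
    (hfin : ∀ x, Module.finrank ℝ (E x) = d) (k : ℕ) :
    ∫⁻ z, (R.logNorm k 1 z.1 z.2).toENNReal ∂((bernoulli p).prod μ) ≠ ∞ := by
  obtain ⟨c, hc⟩ := exists_toENNReal_elog_exteriorPower_map_le d k
  have h0 : MeasurePreserving (fun ω : ℕ → T => ω 0) (bernoulli p) p :=
    measurePreserving_eval_infinitePi (fun _ : ℕ => p) 0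
  have h1 : MeasurePreserving (Prod.map (fun ω : ℕ → T => ω 0) id) ((bernoulli p).prod μ)
      (p.prod μ) := h0.prod (MeasurePreserving.id μ)
  have h2 := h1.integrable_comp_of_integrable hint
  have h3 : ∫⁻ z : (ℕ → T) × X, ENNReal.ofReal
      (Real.posLog ‖(R.F (z.1 0) z.2).toContinuousLinearMap‖) ∂((bernoulli p).prod μ) ≠ ∞ := by
    have h4 := ((hasFiniteIntegral_iff_norm _).1 h2.2).ne
    refine ne_top_of_le_ne_top h4 (lintegral_mono fun z => ENNReal.ofReal_le_ofReal ?_)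
    exact Real.le_norm_self _
  have hle : ∀ z : (ℕ → T) × X, (R.logNorm k 1 z.1 z.2).toENNReal ≤
      c + k * ENNReal.ofReal (Real.posLog ‖(R.F (z.1 0) z.2).toContinuousLinearMap‖) := fun z => by
    have e : R.logNorm k 1 z.1 z.2 = elog ‖(exteriorPower.map k
        (R.F (z.1 0) z.2 ∘ₗ LinearMap.id)).toContinuousLinearMap‖ := rfl
    rw [← toENNReal_elog _ (norm_nonneg _), e, LinearMap.comp_id]
    exact hc (hfin _) (hfin _) (R.F (z.1 0) z.2)
  refine ne_top_of_le_ne_top ?_ (lintegral_mono hle)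
  rw [lintegral_add_left measurable_const, lintegral_const_mul' _ _ (by simp)]
  simp only [lintegral_const, measure_univ, mul_one]
  exact ENNReal.add_ne_top.2 ⟨ENNReal.coe_ne_top, ENNReal.mul_ne_top (by simp) h3⟩

end RandomBundleMorphism

/-! ### Suprema over spheres and measurability of the supremum of integrals -/

section Compact

variable {K : Type*} [TopologicalSpace K] [Nonempty K]

/-- For b below the right side, the sets {g n ≥ b} are nonempty, closed and nested, so they have a
common point. -/
theorem iSup_iInf_eq_iInf_iSup [CompactSpace K] {g : ℕ → K → EReal} (hc : ∀ n, Continuous (g n))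
    (hg : Antitone g) : ⨆ c, ⨅ n, g n c = ⨅ n, ⨆ c, g n c := by
  refine le_antisymm (iSup_iInf_le_iInf_iSup fun c n => g n c) (le_of_forall_lt fun a ha => ?_)
  obtain ⟨b, hab, hb⟩ := exists_between ha
  refine hab.trans_le ?_
  have hclosed : ∀ n, IsClosed {c | b ≤ g n c} := fun n => isClosed_le continuous_const (hc n)
  obtain ⟨c, hcm⟩ := IsCompact.nonempty_iInter_of_sequence_nonempty_isCompact_isClosed
    (fun n => {c | b ≤ g n c}) (fun n c h => le_trans h (hg n.le_succ c))
    (fun n => by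
      obtain ⟨c, hcb⟩ := lt_iSup_iff.1 (hb.trans_le (iInf_le _ n))
      exact ⟨c, hcb.le⟩)
    (hclosed 0).isCompact hclosed
  exact (le_iInf fun n => Set.mem_iInter.1 hcm n).trans (le_iSup (fun c => ⨅ n, g n c) c)

theorem iSup_eq_iSup_denseSeq [TopologicalSpace.SeparableSpace K] {g : K → EReal}
    (hg : Continuous g) : ⨆ c, g c = ⨆ j, g (TopologicalSpace.denseSeq K j) := by
  refine le_antisymm (iSup_le fun c => ?_) (iSup_le fun j => le_iSup g _)
  exact isClosed_property (TopologicalSpace.denseRange_denseSeq K) (isClosed_le hg continuous_const)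
    (fun j => le_iSup (fun j => g (TopologicalSpace.denseSeq K j)) j) c

theorem iSup_ne_zero_eq_iSup_sphere {F V : Type*} [NormedAddCommGroup F] [NormedSpace ℝ F]
    [AddCommGroup V] [Module ℝ V] (B : F ≃ₗ[ℝ] V) {G : V → EReal}
    (hG : ∀ r : ℝ, r ≠ 0 → ∀ v, G (r • v) = G v) :
    ⨆ v : {v : V // v ≠ 0}, G v = ⨆ c : Metric.sphere (0 : F) 1, G (B c) := by
  refine le_antisymm (iSup_le fun v => ?_) (iSup_le fun c => ?_)
  · have hc0 : ‖B.symm v‖ ≠ 0 := norm_ne_zero_iff.2 fun h => v.2 (by simpa using h)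
    have hc : ‖B.symm v‖⁻¹ • B.symm v ∈ Metric.sphere (0 : F) 1 := by
      rw [mem_sphere_zero_iff_norm, norm_smul, norm_inv, norm_norm, inv_mul_cancel₀ hc0]
    refine le_trans (le_of_eq ?_)
      (le_iSup (fun c : Metric.sphere (0 : F) 1 => G (B c)) ⟨_, hc⟩)
    rw [map_smul, LinearEquiv.apply_symm_apply, hG _ (inv_ne_zero hc0)]
  · have : B c ≠ 0 := fun h => by
      have h0 : (c : F) = 0 := by simpa using h
      have h1 := mem_sphere_zero_iff_norm.1 c.2
      simp [h0] at h1
    exact le_iSup (fun v : {v : V // v ≠ 0} => G v) ⟨_, this⟩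

end Compact

namespace RandomBundleMorphism

variable {T : Type*} [MeasurableSpace T] {d : ℕ} {X : Type*} [MeasurableSpace X] {E : X → Type*}
  [∀ x, NormedAddCommGroup (E x)] [∀ x, InnerProductSpace ℝ (E x)] [MeasurableSpace (Total d E)]
  (R : RandomBundleMorphism T d E) [∀ x, FiniteDimensional ℝ (E x)]

theorem logGrowth_smul (k n : ℕ) (ω : ℕ → T) (x : X) {r : ℝ} (hr : r ≠ 0) (v : ⋀[ℝ]^k (E x)) :
    R.logGrowth k n ω x (r • v) = R.logGrowth k n ω x v := by
  rw [logGrowth, logGrowth, map_smul, norm_smul, norm_smul,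
    mul_div_mul_left _ _ (norm_ne_zero_iff.2 hr)]

theorem logGrowth_le_logNorm (k n : ℕ) (ω : ℕ → T) (x : X) (v : ⋀[ℝ]^k (E x)) :
    R.logGrowth k n ω x v ≤ R.logNorm k n ω x :=
  elog_div_le_elog_norm _ v

theorem continuous_logGrowth (L : ∀ x, E x ≃ₗ[ℝ] EuclideanSpace ℝ (Fin d)) (k n : ℕ)
    (ω : ℕ → T) (x : X) :
    Continuous fun c : Metric.sphere (0 : EuclideanSpace ℝ (Set.powersetCard (Fin d) k)) 1 =>
      R.logGrowth k n ω x (exteriorFrame L k x c) := by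
  have h1 : Continuous (exteriorFrame L k x) :=
    (exteriorFrame L k x).toLinearMap.continuous_of_finiteDimensional
  have h2 : Continuous (exteriorPower.map k (R.iter ω x n)) :=
    (exteriorPower.map k (R.iter ω x n)).continuous_of_finiteDimensional
  refine continuous_elog.comp (Continuous.div ?_ ?_ fun c => ?_)
  · exact (h2.comp (h1.comp continuous_subtype_val)).norm
  · exact (h1.comp continuous_subtype_val).norm
  · refine norm_ne_zero_iff.2 fun h => ?_
    have h0 : (c : EuclideanSpace ℝ (Set.powersetCard (Fin d) k)) = 0 := by simpa using h
    have h1 := mem_sphere_zero_iff_norm.1 c.2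
    simp [h0] at h1

theorem logNorm_eq_iSup (L : ∀ x, E x ≃ₗ[ℝ] EuclideanSpace ℝ (Fin d)) (k n : ℕ)
    [Nonempty (Metric.sphere (0 : EuclideanSpace ℝ (Set.powersetCard (Fin d) k)) 1)]
    (ω : ℕ → T) (x : X) :
    R.logNorm k n ω x = ⨆ j : ℕ, R.logGrowth k n ω x (exteriorFrame L k x
        (TopologicalSpace.denseSeq
      (Metric.sphere (0 : EuclideanSpace ℝ (Set.powersetCard (Fin d) k)) 1) j)) := by
  rw [← iSup_logGrowth, iSup_ne_zero_eq_iSup_sphere (exteriorFrame L k x)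
    (fun r hr v => R.logGrowth_smul k n ω x hr v),
    iSup_eq_iSup_denseSeq (R.continuous_logGrowth L k n ω x)]

theorem measurable_logNorm (hE : IsMeasurableEuclideanBundle d E)
    {L : ∀ x, E x ≃ₗ[ℝ] EuclideanSpace ℝ (Fin d)}
    (hL : ∀ v, Measurable (fun x => (⟨x, (L x).symm v⟩ : Total d E))) (k n : ℕ)
    [Nonempty (Metric.sphere (0 : EuclideanSpace ℝ (Set.powersetCard (Fin d) k)) 1)] :
    Measurable fun z : (ℕ → T) × X => R.logNorm k n z.1 z.2 := by
  simp only [R.logNorm_eq_iSup L]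
  exact Measurable.iSup fun j => R.measurable_logGrowth hE hL k n _

theorem measurable_logGrowth_left (hE : IsMeasurableEuclideanBundle d E)
    {L : ∀ x, E x ≃ₗ[ℝ] EuclideanSpace ℝ (Fin d)}
    (hL : ∀ v, Measurable (fun x => (⟨x, (L x).symm v⟩ : Total d E))) (k n : ℕ) (x : X)
    (v : ⋀[ℝ]^k (E x)) : Measurable fun ω : ℕ → T => R.logGrowth k n ω x v := by
  have h := (R.measurable_logGrowth hE hL k n ((exteriorFrame L k x).symm v)).comp
    (measurable_prodMk_right (y := x))
  simpa [Function.comp_def] using h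

/-- Expresses the supremum by countable operations, hence measurably in x. In frame coordinates the
lines are points of a sphere independent of x. The truncated integrals are continuous there by
dominated convergence and decrease to the integral, so compactness exchanges supremum and infimum,
and a dense sequence then suffices. -/
theorem iSup_eintegral_logGrowth_eq (hE : IsMeasurableEuclideanBundle d E)
    {L : ∀ x, E x ≃ₗ[ℝ] EuclideanSpace ℝ (Fin d)}
    (hL : ∀ v, Measurable (fun x => (⟨x, (L x).symm v⟩ : Total d E))) (k n : ℕ)
    [Nonempty (Metric.sphere (0 : EuclideanSpace ℝ (Set.powersetCard (Fin d) k)) 1)]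
    (P : Measure (ℕ → T)) [IsProbabilityMeasure P] (x : X)
    (hq : QuasiIntegrable P fun ω => R.logNorm k n ω x) :
    ⨆ v : {v : ⋀[ℝ]^k (E x) // v ≠ 0}, eintegral P (fun ω => R.logGrowth k n ω x v) =
      ⨅ M : ℕ, ⨆ j : ℕ, (((∫⁻ ω, (R.logGrowth k n ω x (exteriorFrame L k x
        (TopologicalSpace.denseSeq
        (Metric.sphere (0 : EuclideanSpace ℝ (Set.powersetCard (Fin d) k)) 1) j)) + M).toENNReal ∂P
          : ℝ≥0∞) : EReal) - M) := by
  have hqv : ∀ v, QuasiIntegrable P fun ω => R.logGrowth k n ω x v := fun v =>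
    hq.mono (R.measurable_logGrowth_left hE hL k n x v).aemeasurable
      (ae_of_all _ fun ω => R.logGrowth_le_logNorm k n ω x v)
  set g : ℕ → Metric.sphere (0 : EuclideanSpace ℝ (Set.powersetCard (Fin d) k)) 1 → EReal :=
    fun M c => ((∫⁻ ω, (R.logGrowth k n ω x (exteriorFrame L k x c) + M).toENNReal ∂P
      : ℝ≥0∞) : EReal) - M with hg
  have hgc : ∀ M, Continuous (g M) := fun M => by
    have hM : (M : EReal) = ((M : ℝ) : EReal) := by norm_cast
    have hlint : Continuous fun c : Metric.sphere
        (0 : EuclideanSpace ℝ (Set.powersetCard (Fin d) k)) 1 =>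
          ∫⁻ ω, (R.logGrowth k n ω x (exteriorFrame L k x c) + M).toENNReal ∂P := by
      refine continuous_iff_continuousAt.2 fun c => ?_
      refine tendsto_lintegral_filter_of_dominated_convergence
        (fun ω => (R.logNorm k n ω x).toENNReal + M) (Eventually.of_forall fun c =>
          ((R.measurable_logGrowth_left hE hL k n x _).add_const _).ereal_toENNReal)
        (Eventually.of_forall fun c => ae_of_all _ fun ω => ?_) ?_ (ae_of_all _ fun ω => ?_)
      · rw [← toENNReal_add_natCast_add]
        refine le_trans (EReal.toENNReal_le_toENNReal ?_) le_self_add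
        gcongr
        exact R.logGrowth_le_logNorm k n ω x _
      · rw [lintegral_add_right _ measurable_const]
        simpa using hq.2.ne
      · exact (EReal.continuous_toENNReal.comp ((continuous_add_natCast M).comp
          (R.continuous_logGrowth L k n ω x))).continuousAt
    simp only [hg, hM]
    simp only [← hM]
    rw [hM]
    exact (continuous_sub_coe M).comp (continuous_coe_ennreal_ereal.comp hlint)
  have hga : Antitone g := fun M M' h c => (hqv _).antitone_trunc h
  rw [iSup_ne_zero_eq_iSup_sphere (exteriorFrame L k x)
    (G := fun v => eintegral P (fun ω => R.logGrowth k n ω x v))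
    (fun r hr v => by simp only [R.logGrowth_smul k n _ x hr v])]
  calc _ = ⨆ c, ⨅ M, g M c := iSup_congr fun c => (hqv _).eintegral_eq_iInf_trunc
    _ = ⨅ M, ⨆ c, g M c := iSup_iInf_eq_iInf_iSup hgc hga
    _ = _ := iInf_congr fun M => iSup_eq_iSup_denseSeq (hgc M)

theorem measurable_iInf_iSup_trunc (hE : IsMeasurableEuclideanBundle d E)
    {L : ∀ x, E x ≃ₗ[ℝ] EuclideanSpace ℝ (Fin d)}
    (hL : ∀ v, Measurable (fun x => (⟨x, (L x).symm v⟩ : Total d E))) (k n : ℕ)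
    (P : Measure (ℕ → T)) [IsProbabilityMeasure P]
    (c : ℕ → EuclideanSpace ℝ (Set.powersetCard (Fin d) k)) :
    Measurable fun x => ⨅ M : ℕ, ⨆ j : ℕ, (((∫⁻ ω, (R.logGrowth k n ω x
      (exteriorFrame L k x (c j)) + M).toENNReal ∂P : ℝ≥0∞) : EReal) - M) := by
  refine Measurable.iInf fun M => Measurable.iSup fun j => ?_
  simp only [sub_eq_add_neg]
  refine Measurable.add_const (measurable_coe_ennreal_ereal.comp ?_) _
  exact ((R.measurable_logGrowth hE hL k n (c j)).add_const _).ereal_toENNReal.lintegral_prod_left'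

end RandomBundleMorphism

/-! ### Growth rates, exponents and the two limit formulas -/

theorem nonempty_sphere_euclideanSpace_powersetCard {d k : ℕ} (hkd : k ≤ d) :
    Nonempty (Metric.sphere (0 : EuclideanSpace ℝ (Set.powersetCard (Fin d) k)) 1) := by
  classical
  obtain ⟨s, hs⟩ := Finset.exists_subset_card_eq (s := (Finset.univ : Finset (Fin d))) (n := k)
    (by simpa using hkd)
  exact ⟨⟨EuclideanSpace.single (⟨s, hs.2⟩ : Set.powersetCard (Fin d) k) 1, by simp⟩⟩

/-- Addition on `EReal` is continuous at (-∞, b) as long as b ≠ +∞. -/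
theorem tendsto_bot_add {u v : ℕ → EReal} {b : EReal} (hb : b ≠ ⊤)
    (hu : Tendsto u atTop (𝓝 ⊥)) (hv : Tendsto v atTop (𝓝 b)) :
    Tendsto (fun n => u n + v n) atTop (𝓝 ⊥) := by
  have h := (EReal.continuousAt_add (p := (⊥, b)) (Or.inl (by simp)) (Or.inr hb)).tendsto.comp
    (hu.prodMk_nhds hv)
  simpa [Function.comp_def] using h

theorem tendsto_sub_coe_div {u : ℕ → EReal} {b : EReal} (c : ℝ)
    (hu : Tendsto (fun n : ℕ => u n / n) atTop (𝓝 b)) :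
    Tendsto (fun n : ℕ => (u n - (c : EReal)) / n) atTop (𝓝 b) := by
  have e : (fun n : ℕ => (u n - (c : EReal)) / n) = fun n : ℕ => u n / n + -((c : EReal) / n) :=
    funext fun n => by rw [sub_div_natCast, sub_eq_add_neg]
  rw [e]
  have hc := (continuous_neg.tendsto (0 : EReal)).comp (tendsto_coe_div_natCast c)
  have h := (EReal.continuousAt_add (p := (b, -0)) (Or.inr (by simp))
    (Or.inr (by simp))).tendsto.comp (hu.prodMk_nhds hc)
  simpa [Function.comp_def] using h

namespace RandomBundleMorphism

variable {T : Type*} [MeasurableSpace T] {d : ℕ} {X : Type*} [MeasurableSpace X] {E : X → Type*}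
  [∀ x, NormedAddCommGroup (E x)] [∀ x, InnerProductSpace ℝ (E x)] [MeasurableSpace (Total d E)]
  (R : RandomBundleMorphism T d E) [∀ x, FiniteDimensional ℝ (E x)]

/-- The bound k ≤ d makes the exterior power nonzero, so the identity has norm 1; on a zero space
the value would be -∞. -/
theorem logNorm_zero_right {k : ℕ} (hkd : k ≤ d) (hfin : ∀ x, Module.finrank ℝ (E x) = d)
    (ω : ℕ → T) (x : X) : R.logNorm k 0 ω x = 0 := by
  have : Nontrivial (⋀[ℝ]^k (E x)) := by
    refine Module.nontrivial_of_finrank_pos (R := ℝ) ?_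
    rw [exteriorPower.finrank_eq, hfin]
    exact Nat.choose_pos hkd
  have e : (exteriorPower.map k (R.iter ω x 0)).toContinuousLinearMap =
      ContinuousLinearMap.id ℝ (⋀[ℝ]^k (E x)) := by
    ext v : 1
    change exteriorPower.map k (LinearMap.id : E x →ₗ[ℝ] E x) v = v
    rw [exteriorPower.map_id, LinearMap.id_apply]
  rw [logNorm]
  refine Eq.trans (congrArg elog ?_) elog_one
  exact (congrArg norm e).trans ContinuousLinearMap.norm_id

variable {p : Measure T} [IsProbabilityMeasure p] {μ : Measure X} [IsProbabilityMeasure μ]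

theorem finrank_fiber (L : ∀ x, E x ≃ₗ[ℝ] EuclideanSpace ℝ (Fin d)) (x : X) :
    Module.finrank ℝ (E x) = d := by
  rw [(L x).finrank_eq, finrank_euclideanSpace, Fintype.card_fin]

/-- Kingman's theorem in the mean for the exterior powers of the cocycle. -/
theorem tendsto_eintegral_logNorm_div (hE : IsMeasurableEuclideanBundle d E)
    (hμ : R.IsStationary p μ) (hint : R.LogIntegrable p μ) {k : ℕ} (hkd : k ≤ d) :
    (∀ n, QuasiIntegrable ((bernoulli p).prod μ) fun z => R.logNorm k n z.1 z.2) ∧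
      QuasiIntegrable ((bernoulli p).prod μ) (R.pointwiseSum k) ∧
      Tendsto (fun n : ℕ => eintegral ((bernoulli p).prod μ) (fun z => R.logNorm k n z.1 z.2) / n)
        atTop (𝓝 (eintegral ((bernoulli p).prod μ) (R.pointwiseSum k))) := by
  obtain ⟨L, hL⟩ := hE.exists_global_trivialization
  have := nonempty_sphere_euclideanSpace_powersetCard hkd
  exact tendsto_eintegral_div_of_subadditive (R.measurePreserving_skew hμ)
    (fun n => R.measurable_logNorm hE hL k n)
    (fun z => R.logNorm_zero_right hkd (finrank_fiber L) z.1 z.2)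
    (fun n m z => R.logNorm_add_le k n m z)
    (R.lintegral_logNorm_one_ne_top hint (finrank_fiber L) k)

theorem sumRate_of_pos (m : Measure ((ℕ → T) × X)) {k : ℕ} (hk : 1 ≤ k) :
    R.sumRate m k = eintegral m (R.pointwiseSum k) :=
  if_neg (by omega)

/-- Once the growth rate of the volumes is `-∞`, it remains so in all higher dimensions. -/
theorem sumRate_succ_eq_bot (hE : IsMeasurableEuclideanBundle d E)
    (hμ : R.IsStationary p μ) (hint : R.LogIntegrable p μ) {k : ℕ} (hk : 1 ≤ k) (hkd : k + 1 ≤ d)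
    (hbot : R.sumRate ((bernoulli p).prod μ) k = ⊥) :
    R.sumRate ((bernoulli p).prod μ) (k + 1) = ⊥ := by
  set m := (bernoulli p).prod μ with hm
  obtain ⟨L, hL⟩ := hE.exists_global_trivialization
  rw [R.sumRate_of_pos m hk] at hbot
  rw [R.sumRate_of_pos m (by omega)]
  obtain ⟨c, hc⟩ := exists_elog_exteriorPower_map_succ_le d k
  -- Integrating and dividing by n gives Σ_{k+1}(m) ≤ Σ_k(m) + Σ_1(m), and Σ_1(m) < +∞.
  have hle : ∀ (n : ℕ) (z : (ℕ → T) × X), R.logNorm (k + 1) n z.1 z.2 - ((c : ℝ) : EReal) ≤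
      R.logNorm k n z.1 z.2 + R.logNorm 1 n z.1 z.2 := fun n z => by
    refine EReal.sub_le_of_le_add' ((hc (finrank_fiber L _) (finrank_fiber L _) _).trans ?_)
    exact add_le_add le_rfl
      (add_le_add le_rfl (elog_mono (norm_le_norm_exteriorPower_map_one _)))
  obtain ⟨hq0, -, ht0⟩ := R.tendsto_eintegral_logNorm_div hE hμ hint (k := k) (by omega)
  obtain ⟨hq1, hs1, ht1⟩ := R.tendsto_eintegral_logNorm_div hE hμ hint (k := 1) (by omega)
  obtain ⟨hq2, -, ht2⟩ := R.tendsto_eintegral_logNorm_div hE hμ hint hkd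
  rw [← hm] at *
  rw [hbot] at ht0
  have hlim := tendsto_bot_add hs1.eintegral_lt_top.ne ht0 ht1
  refine tendsto_nhds_unique (tendsto_sub_coe_div (c : ℝ) ht2)
    (tendsto_of_tendsto_of_tendsto_of_le_of_le tendsto_const_nhds hlim (fun _ => bot_le)
      fun n => ?_)
  dsimp only
  rw [← (hq2 n).eintegral_sub_const, ← EReal.add_div_of_nonneg_right (Nat.cast_nonneg' n),
    ← (eintegral_add (hq0 n) (hq1 n)).1]
  exact EReal.div_le_div_right_of_nonneg (Nat.cast_nonneg' n)
    (eintegral_mono_ae (ae_of_all _ (hle n)))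

/-- The sum telescopes while the rates are finite. From the first rate equal to -∞ on, the
convention for the exponents makes the sum -∞, which matches by `sumRate_succ_eq_bot`. -/
theorem sum_lyapunovExponent_eq_sumRate (hE : IsMeasurableEuclideanBundle d E)
    (hμ : R.IsStationary p μ) (hint : R.LogIntegrable p μ) {k : ℕ} (hkd : k ≤ d) :
    ∑ i ∈ Finset.Icc 1 k, R.lyapunovExponent ((bernoulli p).prod μ) i =
      R.sumRate ((bernoulli p).prod μ) k := by
  induction k with
  | zero => simp [sumRate]
  | succ k ih =>
    rw [Finset.sum_Icc_succ_top (by omega), ih (by omega), lyapunovExponent, Nat.add_sub_cancel]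
    split_ifs with hbot
    · have hk : 1 ≤ k := Nat.one_le_iff_ne_zero.2 fun h => by simp [h, sumRate] at hbot
      rw [R.sumRate_succ_eq_bot hE hμ hint hk hkd hbot, EReal.add_bot]
    · have htop : R.sumRate ((bernoulli p).prod μ) k ≠ ⊤ := by
        rcases Nat.eq_zero_or_pos k with rfl | hk
        · simp [sumRate]
        · rw [R.sumRate_of_pos _ hk]
          exact (R.tendsto_eintegral_logNorm_div hE hμ hint
            (by omega : k ≤ d)).2.1.eintegral_lt_top.ne
      lift R.sumRate ((bernoulli p).prod μ) k to ℝ using ⟨htop, hbot⟩ with s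
      rw [add_comm, EReal.sub_add_cancel]

/-- The supremum over the directions of the mean logarithmic growth differs from the mean
logarithmic norm by a constant that only depends on the dimension. -/
theorem eintegral_logNorm_sub_le_iSup (hE : IsMeasurableEuclideanBundle d E)
    {L : ∀ x, E x ≃ₗ[ℝ] EuclideanSpace ℝ (Fin d)}
    (hL : ∀ v, Measurable (fun x => (⟨x, (L x).symm v⟩ : Total d E))) {k : ℕ} (hkd : k ≤ d) (n : ℕ)
    (P : Measure (ℕ → T)) [IsProbabilityMeasure P] (x : X)
    (hq : QuasiIntegrable P fun ω => R.logNorm k n ω x) :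
    eintegral P (fun ω => R.logNorm k n ω x) -
        (((gaussianDefect (d.choose k)).toNNReal : ℝ) : EReal) ≤
      ⨆ v : {v : ⋀[ℝ]^k (E x) // v ≠ 0}, eintegral P (fun ω => R.logGrowth k n ω x v) := by
  have := nonempty_sphere_euclideanSpace_powersetCard hkd
  have hV : Module.finrank ℝ (⋀[ℝ]^k (E x)) = d.choose k := by
    rw [exteriorPower.finrank_eq, finrank_fiber L]
  have hm := (R.measurable_logNorm hE hL k n).comp (measurable_prodMk_right (y := x))
  simp only [Function.comp_def] at hm
  set A : ∀ ω, ⋀[ℝ]^k (E x) →ₗ[ℝ] ⋀[ℝ]^k (E (R.orbit ω x n)) :=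
    fun ω => exteriorPower.map k (R.iter ω x n)
  have h := eintegral_elog_norm_sub_le_iSup (P := P) (V := ⋀[ℝ]^k (E x))
    (W := fun ω => ⋀[ℝ]^k (E (R.orbit ω x n))) (Nat.choose_pos hkd) hV A
  refine h (fun v => ?_) hq hm
  have h := (R.measurable_norm_map_iter hE hL k n ((exteriorFrame L k x).symm v)).comp
    (measurable_prodMk_right (y := x))
  simpa [Function.comp_def] using h

end RandomBundleMorphism

end RandomBundle

end

theorem mainTheorem9
    {T : Type*} [MeasurableSpace T] [StandardBorelSpace T]
    {X : Type*} [MeasurableSpace X] [StandardBorelSpace X]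
    (d : ℕ) (E : X → Type*) [∀ x, NormedAddCommGroup (E x)] [∀ x, InnerProductSpace ℝ (E x)]
    [∀ x, FiniteDimensional ℝ (E x)] [MeasurableSpace (RandomBundle.Total d E)]
    (hE : RandomBundle.IsMeasurableEuclideanBundle d E)
    (R : RandomBundle.RandomBundleMorphism T d E)
    (p : Measure T) [IsProbabilityMeasure p]
    (μ : Measure X) [IsProbabilityMeasure μ]
    (hμ : R.IsStationary p μ) (hint : R.LogIntegrable p μ)
    (k : ℕ) (hk : 1 ≤ k) (hkd : k ≤ d) :
    -- all the integrals below are well defined in `[-∞, ∞)`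
    (∀ i ∈ Finset.Icc 1 k,
      RandomBundle.QuasiIntegrable ((RandomBundle.bernoulli p).prod μ) (R.pointwiseSum i)) ∧
    (∀ n : ℕ, ∀ᵐ x ∂μ,
      RandomBundle.QuasiIntegrable (RandomBundle.bernoulli p)
        (fun ω => ⨆ v : {v : ⋀[ℝ]^k (E x) // v ≠ 0}, R.logGrowth k n ω x v) ∧
      ∀ v : ⋀[ℝ]^k (E x), v ≠ 0 →
        RandomBundle.QuasiIntegrable (RandomBundle.bernoulli p)
          (fun ω => R.logGrowth k n ω x v)) ∧
    (∀ n : ℕ, RandomBundle.QuasiIntegrable μ (fun x =>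
      RandomBundle.eintegral (RandomBundle.bernoulli p) (fun ω =>
        ⨆ v : {v : ⋀[ℝ]^k (E x) // v ≠ 0}, R.logGrowth k n ω x v))) ∧
    (∀ n : ℕ, RandomBundle.QuasiIntegrable μ (fun x =>
      ⨆ v : {v : ⋀[ℝ]^k (E x) // v ≠ 0},
        RandomBundle.eintegral (RandomBundle.bernoulli p) (fun ω => R.logGrowth k n ω x v))) ∧
    -- the two limit formulas
    Tendsto (fun n : ℕ =>
        RandomBundle.eintegral μ (fun x =>
          RandomBundle.eintegral (RandomBundle.bernoulli p) (fun ω =>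
            ⨆ v : {v : ⋀[ℝ]^k (E x) // v ≠ 0}, R.logGrowth k n ω x v)) / (n : EReal))
      atTop
      (𝓝 (∑ i ∈ Finset.Icc 1 k,
        R.lyapunovExponent ((RandomBundle.bernoulli p).prod μ) i)) ∧
    Tendsto (fun n : ℕ =>
        RandomBundle.eintegral μ (fun x =>
          ⨆ v : {v : ⋀[ℝ]^k (E x) // v ≠ 0},
            RandomBundle.eintegral (RandomBundle.bernoulli p)
              (fun ω => R.logGrowth k n ω x v)) / (n : EReal))
      atTop
      (𝓝 (∑ i ∈ Finset.Icc 1 k,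
        R.lyapunovExponent ((RandomBundle.bernoulli p).prod μ) i)) := by
  obtain ⟨L, hL⟩ := hE.exists_global_trivialization
  have := RandomBundle.nonempty_sphere_euclideanSpace_powersetCard hkd
  obtain ⟨hq, -, hlim⟩ := R.tendsto_eintegral_logNorm_div hE hμ hint hkd
  have hprod := fun n => RandomBundle.eintegral_prod (R.measurable_logNorm hE hL k n) (hq n)
  have hqU := fun n => (hprod n).2.1
  have hqx := fun n => (hprod n).2.2
  have hUlim := hlim
  simp only [← (hprod _).1] at hUlim
  rw [R.sum_lyapunovExponent_eq_sumRate hE hμ hint hkd, R.sumRate_of_pos _ hk]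
  simp only [R.iSup_logGrowth]
  have hqv : ∀ n, ∀ᵐ x ∂μ, ∀ v : ⋀[ℝ]^k (E x),
      RandomBundle.QuasiIntegrable (RandomBundle.bernoulli p)
        (fun ω => R.logGrowth k n ω x v) := fun n => by
    filter_upwards [hqx n] with x hx v
    exact hx.mono (R.measurable_logGrowth_left hE hL k n x v).aemeasurable
      (ae_of_all _ fun ω => R.logGrowth_le_logNorm k n ω x v)
  have hBU : ∀ n x, (⨆ v : {v : ⋀[ℝ]^k (E x) // v ≠ 0},
      RandomBundle.eintegral (RandomBundle.bernoulli p) (fun ω => R.logGrowth k n ω x v)) ≤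
        RandomBundle.eintegral (RandomBundle.bernoulli p) (fun ω => R.logNorm k n ω x) :=
    fun n x => iSup_le fun v => RandomBundle.eintegral_mono_ae
      (ae_of_all _ fun ω => R.logGrowth_le_logNorm k n ω x v)
  have hqB : ∀ n, RandomBundle.QuasiIntegrable μ (fun x =>
      ⨆ v : {v : ⋀[ℝ]^k (E x) // v ≠ 0},
        RandomBundle.eintegral (RandomBundle.bernoulli p)
          (fun ω => R.logGrowth k n ω x v)) := fun n => by
    -- The countable formula is a measurable version, equal to the supremum at those x whose fibre
    -- integral is well defined, hence almost everywhere.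
    refine (hqU n).mono ⟨_, R.measurable_iInf_iSup_trunc hE hL k n (RandomBundle.bernoulli p)
      (fun j => TopologicalSpace.denseSeq
        (Metric.sphere (0 : EuclideanSpace ℝ (Set.powersetCard (Fin d) k)) 1) j), ?_⟩
      (ae_of_all _ (hBU n))
    filter_upwards [hqx n] with x hx
    exact R.iSup_eintegral_logGrowth_eq hE hL k n (RandomBundle.bernoulli p) x hx
  refine ⟨fun i hi => (R.tendsto_eintegral_logNorm_div hE hμ hint
      ((Finset.mem_Icc.1 hi).2.trans hkd)).2.1,
    fun n => ((hqx n).and (hqv n)).mono fun x hx => ⟨hx.1, fun v _ => hx.2 v⟩, hqU, hqB, hUlim,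
    -- Squeeze: the second sequence lies between the first and the first lowered by K/n, where K
    -- depends only on the dimension of ∧^k.
    tendsto_of_tendsto_of_tendsto_of_le_of_le
      (RandomBundle.tendsto_sub_coe_div
        ((RandomBundle.gaussianDefect (d.choose k)).toNNReal : ℝ) hUlim) hUlim
      (fun n => ?_) (fun n => ?_)⟩
  · dsimp only
    rw [← (hqU n).eintegral_sub_const]
    refine EReal.div_le_div_right_of_nonneg (Nat.cast_nonneg' n)
      (RandomBundle.eintegral_mono_ae ?_)
    filter_upwards [hqx n] with x hx
    exact R.eintegral_logNorm_sub_le_iSup hE hL hkd n (RandomBundle.bernoulli p) x hx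
  · exact EReal.div_le_div_right_of_nonneg (Nat.cast_nonneg' n)
      (RandomBundle.eintegral_mono_ae (ae_of_all _ (hBU n)))
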